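/- Let $G$ be a compact connected Lie group, $S^1=\mathbb R/2\pi\mathbb Z$, and let $\Omega G$ be the Fréchet Lie group of smooth maps $\gamma\colon S^1\to G$ with $\gamma(0)=1$. Let $\mathrm{Bun}_{\Omega G}$ be the category of smooth principal (right) $\Omega G$-bundles $P\to M$ over smooth manifolds $M$ (finite-dimensional, Hausdorff, second countable, without boundary), with $\Omega G$-bundle maps as morphisms. Let $\mathrm{frBun}_G$ be the category of smooth principal $G$-bundles $\widetilde P\to M\times S^1$ framed over $M\times\{0\}$, i.e. equipped with a smooth section $s_0$ over $M\times\{0\}$, with image $\widetilde P_0=s_0(M\times\{0\})$; its morphisms are the $G$-bundle maps that preserve the framings and cover a map of the form $f\times\mathrm{id}$ with $f\colon N\to M$ smooth. Both categories have projection functors to the category $\mathrm{Man}$ of smooth manifolds, sending $P\to M$, respectively $\widetilde P\to M\times S^1$, to $M$. For an $\Omega G$-bundle $\pi\colon P\to M$ put $\mathcal C(P)=(P\times G\times S^1)/\Omega G$, where $(p,g,\theta)\gamma=(p\gamma,\gamma(\theta)^{-1}g,\theta)$, with projection $[p,g,\theta]\mapsto(\pi(p),\theta)$, $G$-action $[p,g,\theta]h=[p,gh,\theta]$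 and framing $s_0(\pi(p),0)=[p,1,0]$; on morphisms, $\mathcal C(\varphi)[p,g,\theta]=[\varphi(p),g,\theta]$. For a framed $G$-bundle $\tilde\pi\colon\widetilde P\to M\times S^1$ put $\mathcal C^{-1}(\widetilde P)=\eta^*\Omega_{\widetilde P_0}(\widetilde P)$, the pull-back along $\eta(m)(\theta)=(m,\theta)$ of the space of smooth loops $f\colon S^1\to\widetilde P$ with $f(0)\in\widetilde P_0$; thus its fibre over $m$ consists of the smooth $f$ with $\tilde\pi(f(\theta))=(m,\theta)$ and $f(0)\in\widetilde P_0$, and $\Omega G$ acts pointwise; on morphisms, $\mathcal C^{-1}(\varphi)(f)=\varphi\circ f$. Then $\mathcal C(P)$ is a framed $G$-bundle over $M\times S^1$ and $\mathcal C^{-1}(\widetilde P)$ is an $\Omega G$-bundle over $M$, and $\mathcal C\colon\mathrm{Bun}_{\Omega G}\to\mathrm{frBun}_G$ and $\mathcal C^{-1}\colon\mathrm{frBun}_G\to\mathrm{Bun}_{\Omega G}$ are functors that commute with the projections to $\mathrm{Man}$. They are equivalences of categories, inverse to each other up to natural isomorphisms $\alpha\colon\mathcal C^{-1}\circ\mathcal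 C\cong\mathrm{id}$ and $\beta\colon\mathcal C\circ\mathcal C^{-1}\cong\mathrm{id}$ that cover the identity of the base manifolds and are given by $\alpha_P^{-1}(p)=(\theta\mapsto[p,1,\theta])$ and $\beta_{\widetilde P}[f,g,\theta]=f(\theta)g$. Consequently, for every manifold $M$, $\mathcal C$ and $\mathcal C^{-1}$ induce mutually inverse bijections between isomorphism classes of $\Omega G$-bundles over $M$ and isomorphism classes of framed $G$-bundles over $M\times S^1$ (isomorphisms being those that cover the identity of the base). -/

import Mathlib

open CategoryTheory
open scoped Manifold ContDiff

universe u

noncomputable section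

namespace Caloron

/-! ### The category of smooth manifolds -/

/-- A smooth (finite-dimensional, Hausdorff, second countable) manifold without boundary. -/
structure Man : Type (u + 1) where
  dim : ℕ
  carrier : Type u
  [top : TopologicalSpace carrier]
  [charted : ChartedSpace (EuclideanSpace ℝ (Fin dim)) carrier]
  [manifold : IsManifold (𝓡 dim) ∞ carrier]
  [t2 : T2Space carrier]
  [secondCountable : SecondCountableTopology carrier]

instance : CoeSort Man.{u} (Type u) := ⟨Man.carrier⟩

attribute [instance] Man.top Man.charted Man.manifold Man.t2 Man.secondCountable

/-- Morphisms of manifolds are the smooth maps. -/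
instance : Category Man.{u} where
  Hom M N := ContMDiffMap (𝓡 M.dim) (𝓡 N.dim) M N ∞
  id _ := ContMDiffMap.id
  comp f g := ContMDiffMap.comp g f

/-- The underlying function of a morphism of manifolds. -/
def Man.fn {M N : Man.{u}} (f : M ⟶ N) : M → N :=
  fun x => (show ContMDiffMap (𝓡 M.dim) (𝓡 N.dim) M N ∞ from f) x

theorem Man.fn_id (M : Man.{u}) (x : M) : Man.fn (𝟙 M) x = x := rfl

theorem Man.fn_comp {L M N : Man.{u}} (f : L ⟶ M) (g : M ⟶ N) (x : L) :
    Man.fn (f ≫ g) x = Man.fn g (Man.fn f x) := rfl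

/-! ### The loop group -/

section Group

variable (k : ℕ) (G : Type u) [TopologicalSpace G] [ChartedSpace (EuclideanSpace ℝ (Fin k)) G]
  [Group G] [LieGroup (𝓡 k) ∞ G]

/-- The group `ΩG` of all smooth maps `S¹ → G` with value `1` at the base point of the circle.
The circle is the unit circle of `ℂ`; its base point (the angle `0`) is `1 : Circle`, and the angle
coordinate is `Circle.exp : ℝ → Circle`. The group operations are pointwise. -/
def LoopGroup : Subgroup (Circle → G) where
  carrier := {γ | ContMDiff (𝓡 1) (𝓡 k) ∞ γ ∧ γ 1 = 1}
  mul_mem' := by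
    rintro a b ⟨ha, ha'⟩ ⟨hb, hb'⟩
    exact ⟨ha.mul hb, by simp [ha', hb']⟩
  one_mem' := ⟨contMDiff_const, rfl⟩
  inv_mem' := by
    rintro a ⟨ha, ha'⟩
    exact ⟨ha.inv, by simp [ha']⟩

end Group

/-- Smoothness, on a set `U` of the manifold `M`, of a map `u` with values in the Fréchet space
`C^∞(S¹, V)`, whose topology is defined by the norms `sup |∂_θ^j f|`, `j = 0, 1, 2, …`. This space is
the closed subspace of the countable product of Banach spaces `∏_j C(S¹, V)` that consists of the
sequences `(f, ∂_θ f, ∂_θ² f, …)`, so that `u` is smooth if and only if every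
`x ↦ ∂_θ^j (u x)` is smooth as a map into the Banach space `C(S¹, V)`. -/
def FrechetSmoothOn {V : Type} [NormedAddCommGroup V] [NormedSpace ℝ V] {M : Man.{u}}
    (u : M → Circle → V) (U : Set M) : Prop :=
  ∀ j : ℕ, ∃ H : M → C(Circle, V),
    (∀ x ∈ U, ∀ t : ℝ,
      H x (Circle.exp t) = iteratedDeriv j (fun s : ℝ => u x (Circle.exp s)) t) ∧
    ContMDiffOn (𝓡 M.dim) 𝓘(ℝ, C(Circle, V)) ∞ H U

section Bundles

variable (k : ℕ) (G : Type u) [TopologicalSpace G] [ChartedSpace (EuclideanSpace ℝ (Fin k)) G]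
  [Group G] [LieGroup (𝓡 k) ∞ G]

/-- Smoothness, on an open set `U` of the manifold `M`, of a map `h` with values in the Fréchet Lie
group `ΩG`. The standard chart of `ΩG` around a loop `γ₀` has the domain
`{γ | γ₀(θ)⁻¹ γ(θ) ∈ D for all θ}`, where `φ : D → ℝᵏ` is a chart of `G` around `1`, and sends `γ`
to the function `θ ↦ φ (γ₀(θ)⁻¹ γ(θ))` in the (closed affine subspace of functions with value `φ 1`
at the base point of the) Fréchet space `C^∞(S¹, ℝᵏ)`. The map `h` is smooth if near every `x₀` it
takes values in the domain of the chart around `h x₀` and is smooth in that chart. -/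
def LoopSmoothOn {M : Man.{u}} (h : M → LoopGroup k G) (U : Set M) : Prop :=
  ∀ x₀ ∈ U, ∃ W : Set M, IsOpen W ∧ x₀ ∈ W ∧ W ⊆ U ∧
    (∀ x ∈ W, ∀ θ : Circle, ((h x₀).1 θ)⁻¹ * (h x).1 θ ∈
      (chartAt (EuclideanSpace ℝ (Fin k)) (1 : G)).source) ∧
    FrechetSmoothOn
      (fun x θ => chartAt (EuclideanSpace ℝ (Fin k)) (1 : G) (((h x₀).1 θ)⁻¹ * (h x).1 θ)) W

/-! ### `ΩG`-bundles -/

/-- A smooth principal `ΩG`-bundle over the manifold `M`: a space with a free right action of `ΩG`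
whose orbits are the fibres of the projection, and an atlas of local trivialisations
`(x, γ) ↦ σ(x) γ` over open sets `U` that cover `M`, with transition functions that are smooth maps
into the Fréchet Lie group `ΩG`. A local trivialisation is recorded as the pair `(U, σ)` of its
domain and its local section (only the values of `σ` on `U` matter). The Fréchet manifold structure
of the total space is the one for which the local trivialisations are diffeomorphisms. -/
structure LoopBundle (M : Man.{u}) where
  total : Type u
  proj : total → M
  act : total → LoopGroup k G → total
  act_one : ∀ p, act p 1 = p
  act_mul : ∀ p γ δ, act p (γ * δ) = act (act p γ) δ
  proj_act : ∀ p γ, proj (act p γ) = proj p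
  free : ∀ p γ, act p γ = p → γ = 1
  transitive : ∀ p q, proj p = proj q → ∃ γ, q = act p γ
  atlas : Set (Set M × (M → total))
  isOpen_atlas : ∀ s ∈ atlas, IsOpen s.1
  section_atlas : ∀ s ∈ atlas, ∀ x ∈ s.1, proj (s.2 x) = x
  cover : ∀ x : M, ∃ s ∈ atlas, x ∈ s.1
  compatible : ∀ s ∈ atlas, ∀ t ∈ atlas, ∃ h : M → LoopGroup k G,
    LoopSmoothOn k G h (s.1 ∩ t.1) ∧ ∀ x ∈ s.1 ∩ t.1, t.2 x = act (s.2 x) (h x)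

variable {k G}

/-- Smoothness of a map from an open set `V` of a manifold `N` to the total space of an
`ΩG`-bundle: its composite with the projection is smooth, and in every local trivialisation
`(x, γ) ↦ σ(x) γ` its `ΩG`-component is smooth. -/
def LoopBundle.SmoothOn {M : Man.{u}} (P : LoopBundle k G M) {N : Man.{u}} (c : N → P.total)
    (V : Set N) : Prop :=
  ContMDiffOn (𝓡 N.dim) (𝓡 M.dim) ∞ (fun y => P.proj (c y)) V ∧
  ∀ s ∈ P.atlas, ∃ h : N → LoopGroup k G,
    LoopSmoothOn k G h (V ∩ (fun y => P.proj (c y)) ⁻¹' s.1) ∧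
    ∀ y ∈ V ∩ (fun y => P.proj (c y)) ⁻¹' s.1, c y = P.act (s.2 (P.proj (c y))) (h y)

variable (k G)

/-- An object of the category of `ΩG`-bundles. -/
structure Bun : Type (u + 1) where
  base : Man.{u}
  bundle : LoopBundle k G base

variable {k G}

/-- An `ΩG`-bundle map: an `ΩG`-equivariant smooth map of total spaces over a smooth map of the
bases. A map out of the Fréchet manifold `X` is smooth if and only if it carries the smooth maps
from finite-dimensional manifolds to `X` to smooth maps. -/
@[ext]
structure Bun.Hom (X Y : Bun k G) where
  base : X.base ⟶ Y.base
  total : X.bundle.total → Y.bundle.total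
  proj_total : ∀ p, Y.bundle.proj (total p) = Man.fn base (X.bundle.proj p)
  total_act : ∀ p γ, total (X.bundle.act p γ) = Y.bundle.act (total p) γ
  smooth : ∀ (N : Man.{u}) (c : N → X.bundle.total) (V : Set N), IsOpen V →
    X.bundle.SmoothOn c V → Y.bundle.SmoothOn (fun y => total (c y)) V

instance : Category (Bun k G) where
  Hom := Bun.Hom
  id X :=
    { base := 𝟙 X.base
      total := fun p => p
      proj_total := fun _ => rfl
      total_act := fun _ _ => rfl
      smooth := fun _ _ _ _ h => h }
  comp f g :=
    { base := f.base ≫ g.base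
      total := fun p => g.total (f.total p)
      proj_total := fun p => by rw [g.proj_total, f.proj_total, Man.fn_comp]
      total_act := fun p γ => by rw [f.total_act, g.total_act]
      smooth := fun N c V hV h => g.smooth N _ V hV (f.smooth N c V hV h) }

variable (k G)

/-- The projection `(P → M) ↦ M`. -/
def Bun.projection : Bun k G ⥤ Man.{u} where
  obj X := X.base
  map f := Bun.Hom.base f

/-! ### Framed `G`-bundles over `M × S¹` -/

/-- The model space of the total space of a `G`-bundle over `M × S¹`. -/
abbrev TotalModelSpace (n : ℕ) : Type :=
  ModelProd (ModelProd (EuclideanSpace ℝ (Fin n)) (EuclideanSpace ℝ (Fin 1)))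
    (EuclideanSpace ℝ (Fin k))

/-- The model with corners (without boundary) of the total space of a `G`-bundle over `M × S¹`. -/
abbrev totalModel (n : ℕ) : ModelWithCorners ℝ
    ((EuclideanSpace ℝ (Fin n) × EuclideanSpace ℝ (Fin 1)) × EuclideanSpace ℝ (Fin k))
    (TotalModelSpace k n) :=
  ((𝓡 n).prod (𝓡 1)).prod (𝓡 k)

/-- A framed `G`-bundle over `M × S¹`: a smooth principal `G`-bundle (a smooth manifold with a smooth
right action of `G` and a smooth projection that is locally, over open sets `U` of `M × S¹`,
equivariantly diffeomorphic to `U × G`, the diffeomorphism being `p ↦ (proj p, ψ p)` with inverse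
`(y, g) ↦ σ(y) g`), with a smooth section `frame` over the submanifold `M × {1}`. -/
structure FramedBundle (M : Man.{u}) where
  total : Type u
  [top : TopologicalSpace total]
  [charted : ChartedSpace (TotalModelSpace k M.dim) total]
  [manifold : IsManifold (totalModel k M.dim) ∞ total]
  proj : total → M × Circle
  act : total → G → total
  act_one : ∀ p, act p 1 = p
  act_mul : ∀ p g h, act p (g * h) = act (act p g) h
  proj_act : ∀ p g, proj (act p g) = proj p
  smooth_proj : ContMDiff (totalModel k M.dim) ((𝓡 M.dim).prod (𝓡 1)) ∞ proj
  smooth_act : ContMDiff ((totalModel k M.dim).prod (𝓡 k)) (totalModel k M.dim) ∞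
    (fun x : total × G => act x.1 x.2)
  locally_trivial : ∀ x : M × Circle, ∃ U : Set (M × Circle), IsOpen U ∧ x ∈ U ∧
    ∃ (ψ : total → G) (σ : M × Circle → total),
      ContMDiffOn (totalModel k M.dim) (𝓡 k) ∞ ψ (proj ⁻¹' U) ∧
      ContMDiffOn ((𝓡 M.dim).prod (𝓡 1)) (totalModel k M.dim) ∞ σ U ∧
      (∀ y ∈ U, proj (σ y) = y) ∧
      (∀ p ∈ proj ⁻¹' U, act (σ (proj p)) (ψ p) = p) ∧
      (∀ y ∈ U, ∀ g : G, ψ (act (σ y) g) = g)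
  frame : M → total
  proj_frame : ∀ m, proj (frame m) = (m, 1)
  smooth_frame : ContMDiff (𝓡 M.dim) (totalModel k M.dim) ∞ frame

attribute [instance] FramedBundle.top FramedBundle.charted FramedBundle.manifold

/-- An object of the category of framed `G`-bundles over manifolds of the form `M × S¹`. -/
structure FrBun : Type (u + 1) where
  base : Man.{u}
  bundle : FramedBundle k G base

variable {k G}

/-- A morphism of framed `G`-bundles: a `G`-bundle map that preserves the framings and covers
`f × id` for a smooth map `f` (the field `base`). -/
@[ext]
structure FrBun.Hom (X Y : FrBun k G) where
  base : X.base ⟶ Y.base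
  total : X.bundle.total → Y.bundle.total
  proj_total : ∀ p, Y.bundle.proj (total p) =
    (Man.fn base (X.bundle.proj p).1, (X.bundle.proj p).2)
  total_act : ∀ p g, total (X.bundle.act p g) = Y.bundle.act (total p) g
  total_frame : ∀ m, total (X.bundle.frame m) = Y.bundle.frame (Man.fn base m)
  smooth : ContMDiff (totalModel k X.base.dim) (totalModel k Y.base.dim) ∞ total

instance : Category (FrBun k G) where
  Hom := FrBun.Hom
  id X :=
    { base := 𝟙 X.base
      total := fun p => p
      proj_total := fun _ => rfl
      total_act := fun _ _ => rfl
      total_frame := fun _ => rfl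
      smooth := contMDiff_id }
  comp f g :=
    { base := f.base ≫ g.base
      total := fun p => g.total (f.total p)
      proj_total := fun p => by rw [g.proj_total, f.proj_total, Man.fn_comp]
      total_act := fun p γ => by rw [f.total_act, g.total_act]
      total_frame := fun m => by rw [f.total_frame, g.total_frame, Man.fn_comp]
      smooth := g.smooth.comp f.smooth }

variable (k G)

/-- The projection `(P → M × S¹) ↦ M`. -/
def FrBun.projection : FrBun k G ⥤ Man.{u} where
  obj X := X.base
  map f := FrBun.Hom.base f

variable {k G}

/-! ### The caloron transform -/

/-- The orbit relation of the right action `(p, g, θ) γ = (p γ, γ(θ)⁻¹ g, θ)` of `ΩG` on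
`P × G × S¹`. -/
def LoopBundle.orbitSetoid {M : Man.{u}} (P : LoopBundle k G M) :
    Setoid (P.total × G × Circle) where
  r a b := ∃ γ : LoopGroup k G, b = (P.act a.1 γ, (γ.1 a.2.2)⁻¹ * a.2.1, a.2.2)
  iseqv :=
    { refl := fun a => ⟨1, by simp [P.act_one]⟩
      symm := by
        rintro ⟨p, g, θ⟩ b ⟨γ, rfl⟩
        exact ⟨γ⁻¹, by simp [← P.act_mul, P.act_one]⟩
      trans := by
        rintro ⟨p, g, θ⟩ b c ⟨γ, rfl⟩ ⟨δ, rfl⟩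
        exact ⟨γ * δ, by simp [P.act_mul, mul_assoc]⟩ }

/-- The set `(P × G × S¹)/ΩG`. -/
def LoopBundle.Assoc {M : Man.{u}} (P : LoopBundle k G M) : Type u := Quotient P.orbitSetoid

/-- The class `[p, g, θ]`. -/
def LoopBundle.cls {M : Man.{u}} (P : LoopBundle k G M) (p : P.total) (g : G) (θ : Circle) :
    P.Assoc :=
  Quotient.mk P.orbitSetoid (p, g, θ)

/-- The framed `G`-bundle `Q`, whose total space is identified by `q` with the set
`(P × G × S¹)/ΩG`, is the caloron transform of `P`: the projection is `[p, g, θ] ↦ (π p, θ)`, the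
action `[p, g, θ] h = [p, g h, θ]`, the framing `s₀(π p) = [p, 1, 1]`, and the quotient map
`P × G × S¹ → Q` is smooth. -/
structure IsCaloronTransform {M : Man.{u}} (P : LoopBundle k G M) (Q : FramedBundle k G M)
    (q : P.Assoc ≃ Q.total) : Prop where
  proj : ∀ p g θ, Q.proj (q (P.cls p g θ)) = (P.proj p, θ)
  act : ∀ p g θ h, Q.act (q (P.cls p g θ)) h = q (P.cls p (g * h) θ)
  frame : ∀ p, Q.frame (P.proj p) = q (P.cls p 1 1)
  smooth : ∀ (N : Man.{u}) (c : N → P.total) (V : Set N), IsOpen V → P.SmoothOn c V →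
    ContMDiffOn ((𝓡 N.dim).prod ((𝓡 k).prod (𝓡 1))) (totalModel k M.dim) ∞
      (fun z : N × G × Circle => q (P.cls (c z.1) z.2.1 z.2.2)) (V ×ˢ Set.univ)

variable (k G)

/-- The caloron transform as a functor: a choice, for every `ΩG`-bundle `P → M`, of a framed
`G`-bundle over `M × S¹` that is its caloron transform `(P × G × S¹)/ΩG`, and for every
`ΩG`-bundle map `φ` the morphism `[p, g, θ] ↦ [φ p, g, θ]` over the same map of manifolds. -/
structure CaloronTransform where
  obj : ∀ {M : Man.{u}}, LoopBundle k G M → FramedBundle k G M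
  quot : ∀ {M : Man.{u}} (P : LoopBundle k G M), P.Assoc ≃ (obj P).total
  isCaloronTransform : ∀ {M : Man.{u}} (P : LoopBundle k G M),
    IsCaloronTransform P (obj P) (quot P)
  map : ∀ {X Y : Bun k G}, (X ⟶ Y) →
    ((⟨X.base, obj X.bundle⟩ : FrBun k G) ⟶ (⟨Y.base, obj Y.bundle⟩ : FrBun k G))
  map_base : ∀ {X Y : Bun k G} (φ : X ⟶ Y), (map φ).base = φ.base
  map_total : ∀ {X Y : Bun k G} (φ : X ⟶ Y) (p : X.bundle.total) (g : G) (θ : Circle),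
    (map φ).total (quot X.bundle (X.bundle.cls p g θ)) =
      quot Y.bundle (Y.bundle.cls (φ.total p) g θ)

variable {k G}

theorem CaloronTransform.exists_cls (c : CaloronTransform k G) {M : Man.{u}}
    (P : LoopBundle k G M) (x : (c.obj P).total) : ∃ p g θ, x = c.quot P (P.cls p g θ) := by
  obtain ⟨y, rfl⟩ := (c.quot P).surjective x
  obtain ⟨⟨p, g, θ⟩, rfl⟩ := Quotient.exists_rep y
  exact ⟨p, g, θ, rfl⟩

/-- The functor `𝒞`. -/
def CaloronTransform.functor (c : CaloronTransform k G) : Bun k G ⥤ FrBun k G where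
  obj X := ⟨X.base, c.obj X.bundle⟩
  map φ := c.map φ
  map_id X := by
    apply FrBun.Hom.ext
    · exact c.map_base _
    · funext x
      obtain ⟨p, g, θ, rfl⟩ := c.exists_cls X.bundle x
      exact c.map_total (𝟙 X) p g θ
  map_comp {X Y Z} φ ψ := by
    apply FrBun.Hom.ext
    · rw [c.map_base]
      change _ = (c.map φ).base ≫ (c.map ψ).base
      rw [c.map_base, c.map_base]
      rfl
    · funext x
      obtain ⟨p, g, θ, rfl⟩ := c.exists_cls X.bundle x
      rw [c.map_total]
      change _ = (c.map ψ).total ((c.map φ).total _)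
      rw [c.map_total, c.map_total]
      rfl

/-! ### The inverse caloron transform -/

/-- The space `Ω_{Q₀}(Q)` of smooth loops in the total space `Q` of a framed bundle whose value at
the base point of the circle lies in the image `Q₀` of the framing. -/
def FramedBundle.basedLoops {M : Man.{u}} (Q : FramedBundle k G M) : Set (Circle → Q.total) :=
  {f | ContMDiff (𝓡 1) (totalModel k M.dim) ∞ f ∧ f 1 ∈ Set.range Q.frame}

/-- The map `η : M → Ω_{M₀}(M × S¹)`, `η(m)(θ) = (m, θ)`. -/
def eta (M : Man.{u}) (m : M) : Circle → M × Circle := fun θ => (m, θ)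

/-- The pull-back `η^* Ω_{Q₀}(Q)` along `η` of the loop bundle
`Ω_{Q₀}(Q) → Ω_{M₀}(M × S¹)`, `f ↦ proj ∘ f`, as a set. -/
@[ext]
structure FramedBundle.EtaPullback {M : Man.{u}} (Q : FramedBundle k G M) : Type u where
  point : M
  loop : Circle → Q.total
  loop_mem : loop ∈ Q.basedLoops
  proj_loop : Q.proj ∘ loop = eta M point

/-- The `ΩG`-bundle `P`, whose total space is identified by `e` with the set `η^* Ω_{Q₀}(Q)`, is the
inverse caloron transform of `Q`: the projection is the one of the pull-back, `ΩG` acts pointwise,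
and the smooth structure is the one of a space of loops, i.e. a map from a manifold to it is smooth
if and only if it is smooth as a function of two variables with values in `Q`. -/
structure IsInverseCaloronTransform {M : Man.{u}} (Q : FramedBundle k G M) (P : LoopBundle k G M)
    (e : P.total ≃ Q.EtaPullback) : Prop where
  proj : ∀ p, (e p).point = P.proj p
  act : ∀ p γ θ, (e (P.act p γ)).loop θ = Q.act ((e p).loop θ) (γ.1 θ)
  smooth_iff : ∀ (N : Man.{u}) (c : N → P.total) (V : Set N), IsOpen V →
    (P.SmoothOn c V ↔ ContMDiffOn ((𝓡 N.dim).prod (𝓡 1)) (totalModel k M.dim) ∞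
      (fun z : N × Circle => (e (c z.1)).loop z.2) (V ×ˢ Set.univ))

variable (k G)

/-- The inverse caloron transform as a functor: a choice, for every framed `G`-bundle
`Q → M × S¹`, of an `ΩG`-bundle over `M` that is its inverse caloron transform `η^* Ω_{Q₀}(Q)`, and
for every morphism `φ` of framed bundles the `ΩG`-bundle map `f ↦ φ ∘ f` over the same map of
manifolds. -/
structure InverseCaloronTransform where
  obj : ∀ {M : Man.{u}}, FramedBundle k G M → LoopBundle k G M
  equiv : ∀ {M : Man.{u}} (Q : FramedBundle k G M), (obj Q).total ≃ Q.EtaPullback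
  isInverseCaloronTransform : ∀ {M : Man.{u}} (Q : FramedBundle k G M),
    IsInverseCaloronTransform Q (obj Q) (equiv Q)
  map : ∀ {X Y : FrBun k G}, (X ⟶ Y) →
    ((⟨X.base, obj X.bundle⟩ : Bun k G) ⟶ (⟨Y.base, obj Y.bundle⟩ : Bun k G))
  map_base : ∀ {X Y : FrBun k G} (φ : X ⟶ Y), (map φ).base = φ.base
  map_total : ∀ {X Y : FrBun k G} (φ : X ⟶ Y) (p : (obj X.bundle).total) (θ : Circle),
    (equiv Y.bundle ((map φ).total p)).loop θ = φ.total ((equiv X.bundle p).loop θ)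

variable {k G}

theorem FramedBundle.EtaPullback.ext_loop {M : Man.{u}} {Q : FramedBundle k G M}
    {a b : Q.EtaPullback} (h : ∀ θ, a.loop θ = b.loop θ) : a = b := by
  have hl : a.loop = b.loop := funext h
  refine FramedBundle.EtaPullback.ext ?_ hl
  have h1 := congrFun a.proj_loop 1
  have h2 := congrFun b.proj_loop 1
  rw [hl] at h1
  exact congrArg Prod.fst (h1.symm.trans h2)

/-- The functor `𝒞⁻¹`. -/
def InverseCaloronTransform.functor (d : InverseCaloronTransform k G) :
    FrBun k G ⥤ Bun k G where
  obj X := ⟨X.base, d.obj X.bundle⟩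
  map φ := d.map φ
  map_id X := by
    apply Bun.Hom.ext
    · exact d.map_base _
    · funext p
      apply (d.equiv X.bundle).injective
      apply FramedBundle.EtaPullback.ext_loop
      intro θ
      exact d.map_total (𝟙 X) p θ
  map_comp {X Y Z} φ ψ := by
    apply Bun.Hom.ext
    · rw [d.map_base]
      change _ = (d.map φ).base ≫ (d.map ψ).base
      rw [d.map_base, d.map_base]
      rfl
    · funext p
      apply (d.equiv Z.bundle).injective
      apply FramedBundle.EtaPullback.ext_loop
      intro θ
      rw [d.map_total]
      change _ = (d.equiv Z.bundle ((d.map ψ).total ((d.map φ).total p))).loop θ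
      rw [d.map_total, d.map_total]
      rfl

/-! ### Isomorphism classes over a fixed manifold -/

variable (k G)

/-- `ΩG`-bundles over `M` up to isomorphisms covering the identity of `M`. -/
def LoopBundle.isoSetoid (M : Man.{u}) : Setoid (LoopBundle k G M) where
  r P P' := ∃ i : (⟨M, P⟩ : Bun k G) ≅ ⟨M, P'⟩, i.hom.base = 𝟙 M
  iseqv :=
    { refl := fun P => ⟨Iso.refl _, rfl⟩
      symm := by
        rintro P P' ⟨i, hi⟩
        refine ⟨i.symm, ?_⟩
        have h : i.hom.base ≫ i.inv.base = 𝟙 M := congrArg Bun.Hom.base i.hom_inv_id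
        rw [hi] at h
        exact (Category.id_comp _).symm.trans h
      trans := by
        rintro P P' P'' ⟨i, hi⟩ ⟨j, hj⟩
        refine ⟨i ≪≫ j, ?_⟩
        change i.hom.base ≫ j.hom.base = 𝟙 M
        rw [hi, hj]
        exact Category.id_comp _ }

/-- Framed `G`-bundles over `M × S¹` up to framed isomorphisms covering the identity. -/
def FramedBundle.isoSetoid (M : Man.{u}) : Setoid (FramedBundle k G M) where
  r Q Q' := ∃ i : (⟨M, Q⟩ : FrBun k G) ≅ ⟨M, Q'⟩, i.hom.base = 𝟙 M
  iseqv :=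
    { refl := fun P => ⟨Iso.refl _, rfl⟩
      symm := by
        rintro P P' ⟨i, hi⟩
        refine ⟨i.symm, ?_⟩
        have h : i.hom.base ≫ i.inv.base = 𝟙 M := congrArg FrBun.Hom.base i.hom_inv_id
        rw [hi] at h
        exact (Category.id_comp _).symm.trans h
      trans := by
        rintro P P' P'' ⟨i, hi⟩ ⟨j, hj⟩
        refine ⟨i ≪≫ j, ?_⟩
        change i.hom.base ≫ j.hom.base = 𝟙 M
        rw [hi, hj]
        exact Category.id_comp _ }

end Bundles

end Caloron

end

/-!
The correspondence rests on the exponential law for the loop group: a map `h` into `ΩG` is smooth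
if and only if `(x, θ) ↦ h(x)(θ)` is smooth (`loopSmoothOn_iff`). In one direction this says that a
sequence of smooth maps `x ↦ ∂_θ^j u(x)` into the Banach space of continuous functions on the circle
assembles to a function that is smooth in both variables; in the other direction, the uniform
estimates for the difference quotients come from the mean value inequality and the compactness of
the circle. After this, smoothness of maps into `ΩG`-bundles is a statement about finite-dimensional
manifolds.

The caloron transform of `P` is obtained by gluing the pieces `U × S¹ × G` given by the local
sections of `P` along their transition maps (`exists_isManifold_of_transitions`,
`LoopBundle.exists_isCaloronTransform`).

For the inverse transform, the point is that the space of based loops is locally trivial, i.e. that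
the framing of a `G`-bundle over `M × S¹` extends locally in `M` to a section over `U × S¹`
(`FramedBundle.exists_section_extending_frame`). Sections over small arcs can be glued to a section
over an arc slightly longer than the circle, without any hypothesis on `G`; the values at the two
ends differ by a `G`-valued function, which can be deformed to the constant `1` because `G` is
connected (`hasSmoothContraction`).

The maps `p ↦ (θ ↦ [p, 1, θ])` and `[f, g, θ] ↦ f(θ) g` are natural bundle maps over the identity of
the base, and such bundle maps are isomorphisms in both categories (`LoopBundle.exists_iso`,
`FramedBundle.exists_iso`). Equivalence of the categories and the bijection of isomorphism classes
follow formally.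
-/

noncomputable section

namespace Caloron

open Set Filter Topology

/-! ### The exponential law for maps into spaces of smooth loops -/

section Euclidean

variable {E V : Type*} [NormedAddCommGroup E] [NormedSpace ℝ E] [NormedAddCommGroup V]
  [NormedSpace ℝ V]

theorem isQuotientMap_circleExp : IsQuotientMap Circle.exp :=
  isLocalHomeomorph_circleExp.isOpenMap.isQuotientMap Circle.exp.continuous
    fun z => ⟨_, Circle.exp_arg z⟩

theorem isQuotientMap_prodMap_circleExp (X : Type*) [TopologicalSpace X] :
    IsQuotientMap (Prod.map id Circle.exp : X × ℝ → X × Circle) :=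
  (IsOpenMap.id.prodMap isLocalHomeomorph_circleExp.isOpenMap).isQuotientMap
    (continuous_id.prodMap Circle.exp.continuous)
    (Function.surjective_id.prodMap fun z => ⟨_, Circle.exp_arg z⟩)

/-- A continuous function of the angle that takes equal values at equal points of the circle
descends to the circle. -/
theorem exists_continuousMap_circle {V : Type*} [TopologicalSpace V] {g : ℝ → V} (hg : Continuous g)
    (hp : ∀ s t, Circle.exp s = Circle.exp t → g s = g t) :
    ∃ K : C(Circle, V), ∀ t, K (Circle.exp t) = g t := by
  have h : ∀ t, g (Complex.arg (Circle.exp t : Circle)) = g t := fun t =>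
    hp _ _ (Circle.exp_arg _)
  refine ⟨⟨fun z => g (Complex.arg z), ?_⟩, h⟩
  rw [isQuotientMap_circleExp.continuous_iff]
  exact hg.congr fun t => (h t).symm

/-- The relation `∂_θ f = g` between continuous functions on the circle is preserved by
differentiation with respect to a parameter, since it is closed in the uniform topology. -/
theorem hasDerivAt_fderiv_circle {A B : E → C(Circle, V)} {W : Set E} (hW : IsOpen W)
    (hA : DifferentiableOn ℝ A W) (hB : DifferentiableOn ℝ B W)
    (hAB : ∀ x ∈ W, ∀ t, HasDerivAt (fun s => A x (Circle.exp s)) (B x (Circle.exp t)) t)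
    {x : E} (hx : x ∈ W) (v : E) (t : ℝ) :
    HasDerivAt (fun s => fderiv ℝ A x v (Circle.exp s)) (fderiv ℝ B x v (Circle.exp t)) t := by
  have slope : ∀ {A : E → C(Circle, V)}, DifferentiableOn ℝ A W →
      Tendsto (fun r : ℝ => r⁻¹ • (A (x + r • v) - A x)) (𝓝[≠] 0) (𝓝 (fderiv ℝ A x v)) := by
    intro A hA
    have h1 : HasFDerivAt A (fderiv ℝ A x) x :=
      (hA.differentiableAt (hW.mem_nhds hx)).hasFDerivAt
    have h2 : HasDerivAt (fun r : ℝ => A (x + r • v)) (fderiv ℝ A x v) 0 := by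
      have h3 : HasDerivAt (fun r : ℝ => x + r • v) v 0 := by
        simpa using ((hasDerivAt_id (0 : ℝ)).smul_const v).const_add x
      have h1' : HasFDerivAt A (fderiv ℝ A x) (x + (0 : ℝ) • v) := by simpa using h1
      exact h1'.comp_hasDerivAt (0 : ℝ) h3
    simpa using hasDerivAt_iff_tendsto_slope_zero.1 h2
  have hnear : ∀ᶠ r : ℝ in 𝓝[≠] 0, x + r • v ∈ W := by
    have : Tendsto (fun r : ℝ => x + r • v) (𝓝 0) (𝓝 x) := by
      have : Continuous (fun r : ℝ => x + r • v) := by fun_prop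
      simpa using this.tendsto 0
    exact nhdsWithin_le_nhds (this.eventually (hW.mem_nhds hx))
  refine hasDerivAt_of_tendstoUniformly (l := 𝓝[≠] (0 : ℝ))
    (f := fun r s => (r⁻¹ • (A (x + r • v) - A x)) (Circle.exp s))
    (f' := fun r s => (r⁻¹ • (B (x + r • v) - B x)) (Circle.exp s))
    (g' := fun s => fderiv ℝ B x v (Circle.exp s)) ?_ ?_ ?_ t
  · exact (ContinuousMap.tendsto_iff_tendstoUniformly.1 (slope hB)).comp Circle.exp
  · filter_upwards [hnear] with r hr s
    exact ((hAB _ hr s).sub (hAB _ hx s)).const_smul r⁻¹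
  · intro s
    exact ((ContinuousMap.evalCLM ℝ (Circle.exp s)).continuous.tendsto _).comp (slope hA)

/-- A sequence of smooth maps `x ↦ ∂_θ^j u(x)` into `C(S¹, V)` gives functions that are smooth in
both variables. -/
theorem contDiffOn_uncurry_of_family [FiniteDimensional ℝ E] {W : Set E} (hW : IsOpen W) (n : ℕ) :
    ∀ H : ℕ → E → C(Circle, V), (∀ j, ContDiffOn ℝ ∞ (H j) W) →
    (∀ j, ∀ x ∈ W, ∀ t,
      HasDerivAt (fun s => H j x (Circle.exp s)) (H (j + 1) x (Circle.exp t)) t) →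
    ∀ j, ContDiffOn ℝ n (fun p : E × ℝ => H j p.1 (Circle.exp p.2)) (W ×ˢ univ) := by
  have hWu : IsOpen (W ×ˢ (univ : Set ℝ)) := hW.prod isOpen_univ
  have cont : ∀ K : E → C(Circle, V), ContinuousOn K W →
      ContinuousOn (fun p : E × ℝ => K p.1 (Circle.exp p.2)) (W ×ˢ univ) := by
    intro K hK
    have h1 : ContinuousOn (fun p : E × ℝ => K p.1) (W ×ˢ univ) :=
      hK.comp continuousOn_fst fun p hp => hp.1
    have h2 : ContinuousOn (fun p : E × ℝ => Circle.exp p.2) (W ×ˢ univ) :=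
      (Circle.exp.continuous.comp continuous_snd).continuousOn
    exact (ContinuousEval.continuous_eval (F := C(Circle, V))).comp_continuousOn (h1.prodMk h2)
  induction n with
  | zero =>
    intro H hH _ j
    exact contDiffOn_zero.2 (cont _ (hH j).continuousOn)
  | succ n ih =>
    intro H hH hd j
    have hdiff : ∀ j, DifferentiableOn ℝ (H j) W := fun j => (hH j).differentiableOn (by simp)
    let f₁ : E → ℝ → E →L[ℝ] V := fun x t =>
      (ContinuousMap.evalCLM ℝ (Circle.exp t)).comp (fderiv ℝ (H j) x)
    let f₂ : E → ℝ → ℝ →L[ℝ] V := fun x t =>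
      ContinuousLinearMap.toSpanSingleton ℝ (H (j + 1) x (Circle.exp t))
    have hf' : ∀ v : E, ∀ i, ContDiffOn ℝ ∞ (fun x => fderiv ℝ (H i) x v) W := fun v i =>
      ((contDiffOn_infty_iff_fderiv_of_isOpen hW).1 (hH i)).2.clm_apply contDiffOn_const
    have c₁ : ContinuousOn ↿f₁ (W ×ˢ univ) := by
      rw [continuousOn_clm_apply]
      intro v
      exact cont _ (hf' v j).continuousOn
    have c₂ : ContinuousOn ↿f₂ (W ×ˢ univ) := by
      rw [continuousOn_clm_apply]
      intro v
      have := (cont _ (hH (j + 1)).continuousOn).const_smul v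
      simpa [f₂, Function.HasUncurry.uncurry] using! this
    have hder : ∀ p ∈ W ×ˢ (univ : Set ℝ), HasFDerivAt
        (fun p : E × ℝ => H j p.1 (Circle.exp p.2)) ((f₁ p.1 p.2).coprod (f₂ p.1 p.2)) p := by
      intro p hp
      refine (hasStrictFDerivAt_uncurry_coprod (f := fun x t => H j x (Circle.exp t))
        (f₁ := f₁) (f₂ := f₂) ?_ ?_ ?_ ?_).hasFDerivAt
      · filter_upwards [hWu.mem_nhds hp] with q hq
        exact (ContinuousMap.evalCLM ℝ (Circle.exp q.2)).hasFDerivAt.comp q.1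
          ((hdiff j).differentiableAt (hW.mem_nhds hq.1)).hasFDerivAt
      · filter_upwards [hWu.mem_nhds hp] with q hq
        exact (hd j q.1 hq.1 q.2).hasFDerivAt
      · exact c₁.continuousAt (hWu.mem_nhds hp)
      · exact c₂.continuousAt (hWu.mem_nhds hp)
    push_cast
    rw [contDiffOn_succ_iff_fderiv_of_isOpen hWu]
    refine ⟨fun p hp => (hder p hp).differentiableAt.differentiableWithinAt, by simp, ?_⟩
    rw [contDiffOn_clm_apply]
    rintro ⟨v, r⟩
    have h1 := ih (fun i x => fderiv ℝ (H i) x v) (hf' v)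
      (fun i x hx t => hasDerivAt_fderiv_circle hW (hdiff i) (hdiff (i + 1)) (hd i) hx v t) j
    have h2 := (ih H hH hd (j + 1)).const_smul r
    refine (h1.add h2).congr fun p hp => ?_
    rw [(hder p hp).fderiv]
    simp [f₁, f₂]

/-- A function that is smooth in both variables defines a smooth map into the Banach space
`C(S¹, V)`. -/
theorem contDiffOn_continuousMap_circle [FiniteDimensional ℝ E] {W : Set E} (hW : IsOpen W)
    (n : ℕ) : ∀ (F : E × ℝ → V) (K : E → C(Circle, V)), ContDiffOn ℝ ∞ F (W ×ˢ univ) →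
    (∀ x ∈ W, ∀ t, K x (Circle.exp t) = F (x, t)) → ContDiffOn ℝ n K W := by
  have hWu : IsOpen (W ×ˢ (univ : Set ℝ)) := hW.prod isOpen_univ
  have cont : ∀ (F : E × ℝ → V) (K : E → C(Circle, V)), ContinuousOn F (W ×ˢ univ) →
      (∀ x ∈ W, ∀ t, K x (Circle.exp t) = F (x, t)) → ContinuousOn K W := by
    intro F K hF hK
    rw [continuousOn_iff_continuous_domRestrict]
    apply ContinuousMap.continuous_of_continuous_uncurry
    rw [(isQuotientMap_prodMap_circleExp W).continuous_iff]
    have : Continuous fun p : W × ℝ => F (p.1.1, p.2) :=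
      hF.comp_continuous (by fun_prop) fun p => ⟨p.1.2, mem_univ _⟩
    exact this.congr fun p => (hK _ p.1.2 _).symm
  induction n with
  | zero => exact fun F K hF hK => contDiffOn_zero.2 (cont F K hF.continuousOn hK)
  | succ n ih =>
    intro F K hF hK
    have hF' := (contDiffOn_infty_iff_fderiv_of_isOpen hWu).1 hF
    have hpart : ∀ v : E, ContDiffOn ℝ ∞ (fun p => fderiv ℝ F p (v, 0)) (W ×ˢ univ) := fun v =>
      hF'.2.clm_apply contDiffOn_const
    have hpartial : ∀ x ∈ W, ∀ t, HasFDerivAt (fun y => F (y, t))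
        ((fderiv ℝ F (x, t)).comp (ContinuousLinearMap.inl ℝ E ℝ)) x := by
      intro x hx t
      have h1 : HasFDerivAt F (fderiv ℝ F (x, t)) (x, t) :=
        (hF'.1.differentiableAt (hWu.mem_nhds ⟨hx, mem_univ t⟩)).hasFDerivAt
      have h2 : HasFDerivAt (fun y : E => (y, t)) (ContinuousLinearMap.inl ℝ E ℝ) x :=
        hasFDerivAt_prodMk_left x t
      exact h1.comp x h2
    -- The partial derivatives in the direction `v` are again functions on the circle.
    have hex : ∀ (v x : E), ∃ D : C(Circle, V), x ∈ W →
        ∀ t, D (Circle.exp t) = fderiv ℝ F (x, t) (v, 0) := by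
      intro v x
      by_cases hx : x ∈ W
      · obtain ⟨D, hD⟩ := exists_continuousMap_circle (g := fun t => fderiv ℝ F (x, t) (v, 0))
          ((hpart v).continuousOn.comp_continuous (by fun_prop) fun t => ⟨hx, mem_univ _⟩) (by
          intro s t hst
          have heq : (fun y => F (y, s)) =ᶠ[𝓝 x] fun y => F (y, t) := by
            filter_upwards [hW.mem_nhds hx] with y hy
            rw [← hK y hy, ← hK y hy, hst]
          have h1 := (hpartial x hx s).unique ((hpartial x hx t).congr_of_eventuallyEq heq)
          simpa using congrArg (fun L : E →L[ℝ] V => L v) h1)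
        exact ⟨D, fun _ => hD⟩
      · exact ⟨0, fun h => absurd h hx⟩
    choose D hD using hex
    let b := Module.finBasis ℝ E
    let L : E → E →L[ℝ] C(Circle, V) := fun x =>
      ∑ i, ContinuousLinearMap.smulRightL ℝ E C(Circle, V)
        (LinearMap.toContinuousLinearMap (b.coord i)) (D (b i) x)
    have hLn : ∀ m : ℕ∞ω, (∀ v, ContDiffOn ℝ m (D v) W) → ContDiffOn ℝ m L W := by
      intro m h
      refine ContDiffOn.sum fun i _ => ?_
      exact (ContinuousLinearMap.contDiff _).comp_contDiffOn (h (b i))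
    have hL : ∀ x ∈ W, ∀ v t, L x v (Circle.exp t) = fderiv ℝ F (x, t) (v, 0) := by
      intro x hx v t
      have h1 : L x v (Circle.exp t) = ∑ i, b.repr v i • fderiv ℝ F (x, t) (b i, 0) := by
        simp [L, hD _ x hx, ContinuousMap.sum_apply]
      have h2 : (v, (0 : ℝ)) = ∑ i, b.repr v i • (b i, (0 : ℝ)) := by
        change LinearMap.inl ℝ E ℝ v = _
        conv_lhs => rw [← b.sum_repr v]
        rw [map_sum]
        simp
      rw [h1, h2, map_sum]
      exact Finset.sum_congr rfl fun i _ => (map_smul _ _ _).symm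
    have hLc : ContinuousOn L W := (hLn 0 fun v => contDiffOn_zero.2
      (cont _ _ (hpart v).continuousOn fun x hx t => hD v x hx t)).continuousOn
    have hder : ∀ x ∈ W, HasFDerivAt K (L x) x := by
      intro x hx
      rw [hasFDerivAt_iff_isLittleO, Asymptotics.isLittleO_iff]
      intro ε hε
      have h1 := hLc.continuousAt (hW.mem_nhds hx)
      have h2 : ∀ᶠ y in 𝓝 x, y ∈ W ∧ ‖L y - L x‖ ≤ ε := by
        filter_upwards [hW.mem_nhds hx, Metric.tendsto_nhds.1 h1 ε hε] with y hy hy'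
        exact ⟨hy, by rw [← dist_eq_norm]; exact hy'.le⟩
      obtain ⟨δ, hδ, hball⟩ := Metric.eventually_nhds_iff_ball.1 h2
      filter_upwards [Metric.ball_mem_nhds x hδ] with y hy
      refine (ContinuousMap.norm_le _ (by positivity)).2 fun z => ?_
      obtain ⟨t, rfl⟩ := isQuotientMap_circleExp.surjective z
      have hxb : x ∈ Metric.ball x δ := Metric.mem_ball_self hδ
      have key := Convex.norm_image_sub_le_of_norm_hasFDerivWithin_le' (𝕜 := ℝ)
        (f := fun y => F (y, t)) (C := ε) (s := Metric.ball x δ) (x := x) (y := y)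
        (f' := fun y => (ContinuousMap.evalCLM ℝ (Circle.exp t)).comp (L y))
        (φ := (ContinuousMap.evalCLM ℝ (Circle.exp t)).comp (L x)) ?_ ?_
        (convex_ball x δ) hxb hy
      · simpa [hK _ (hball y hy).1, hK _ hx] using key
      · intro w hw
        refine (hpartial w (hball w hw).1 t).hasFDerivWithinAt.congr_fderiv ?_
        ext v
        simp [hL w (hball w hw).1]
      · intro w hw
        rw [← ContinuousLinearMap.comp_sub]
        refine ContinuousLinearMap.opNorm_le_bound _ hε.le fun v => ?_
        calc ‖((L w - L x) v) (Circle.exp t)‖ ≤ ‖(L w - L x) v‖ :=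
              ContinuousMap.norm_coe_le_norm _ _
          _ ≤ ‖L w - L x‖ * ‖v‖ := ContinuousLinearMap.le_opNorm _ _
          _ ≤ ε * ‖v‖ := by gcongr; exact (hball w hw).2
    push_cast
    rw [contDiffOn_succ_iff_fderiv_of_isOpen hW]
    refine ⟨fun x hx => (hder x hx).differentiableAt.differentiableWithinAt, by simp, ?_⟩
    refine (hLn n fun v => ih _ _ (hpart v) fun x hx t => hD v x hx t).congr fun x hx => ?_
    exact (hder x hx).fderiv

theorem contDiffOn_iteratedDeriv_snd {W : Set E} (hW : IsOpen W) {F : E × ℝ → V}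
    (hF : ContDiffOn ℝ ∞ F (W ×ˢ univ)) (j : ℕ) :
    ContDiffOn ℝ ∞ (fun p : E × ℝ => iteratedDeriv j (fun s => F (p.1, s)) p.2) (W ×ˢ univ) := by
  have hWu : IsOpen (W ×ˢ (univ : Set ℝ)) := hW.prod isOpen_univ
  induction j with
  | zero => simpa using hF
  | succ j ih =>
    have h := (contDiffOn_infty_iff_fderiv_of_isOpen hWu).1 ih
    refine (h.2.clm_apply (contDiffOn_const (c := ((0 : E), (1 : ℝ))))).congr fun p hp => ?_
    rw [iteratedDeriv_succ]
    have h1 := (h.1.differentiableAt (hWu.mem_nhds hp)).hasFDerivAt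
    have h2 : HasFDerivAt (fun s : ℝ => (p.1, s)) (ContinuousLinearMap.inr ℝ E ℝ) p.2 :=
      hasFDerivAt_prodMk_right p.1 p.2
    have h3 := (h1.comp p.2 h2).hasDerivAt.deriv
    simpa using! h3

end Euclidean

/-! ### Smooth functions on the circle and the angle coordinate -/

/-- There is an angle function on the circle that is smooth near a given point. -/
theorem exists_smooth_angle (z₀ : Circle) : ∃ a : Circle → ℝ,
    (∀ z, Circle.exp (a z) = z) ∧ ContMDiffAt (𝓡 1) 𝓘(ℝ, ℝ) ∞ a z₀ := by
  refine ⟨fun z => Complex.arg z₀ + Complex.arg (z * z₀⁻¹ : Circle), fun z => ?_, ?_⟩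
  · rw [Circle.exp_add, Circle.exp_arg, Circle.exp_arg]
    rw [mul_comm z, mul_inv_cancel_left]
  · have h1 : ContMDiff (𝓡 1) 𝓘(ℝ, ℂ) ∞ (fun z : Circle => ((z * z₀⁻¹ : Circle) : ℂ)) := by
      have : Fact (Module.finrank ℝ ℂ = 1 + 1) := ⟨Complex.finrank_real_complex⟩
      exact contMDiff_coe_sphere.comp (contMDiff_id.mul contMDiff_const)
    have h2 : ContDiffAt ℝ ∞ (fun w : ℂ => Complex.arg z₀ + Complex.arg w)
        ((z₀ * z₀⁻¹ : Circle) : ℂ) := by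
      refine contDiffAt_const.add ?_
      have h3 : ContDiffAt ℝ ∞ Complex.log ((z₀ * z₀⁻¹ : Circle) : ℂ) :=
        (Complex.contDiffAt_log (by simp)).restrict_scalars ℝ
      have h4 := (Complex.imCLM.contDiff (n := ∞)).contDiffAt.comp _ h3
      exact h4.congr_of_eventuallyEq (Eventually.of_forall fun w => (Complex.log_im w).symm)
    exact ContMDiffAt.comp (I' := 𝓘(ℝ, ℂ)) (g := fun w : ℂ => Complex.arg z₀ + Complex.arg w)
      z₀ h2.contMDiffAt h1.contMDiffAt

section Descent

variable {EM HM EX HX : Type*} [NormedAddCommGroup EM] [NormedSpace ℝ EM] [TopologicalSpace HM]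
  {I : ModelWithCorners ℝ EM HM} [NormedAddCommGroup EX] [NormedSpace ℝ EX] [TopologicalSpace HX]
  {J : ModelWithCorners ℝ EX HX} {M X : Type*} [TopologicalSpace M] [ChartedSpace HM M]
  [TopologicalSpace X] [ChartedSpace HX X]

theorem contMDiffOn_prod_circle_iff {f : M × Circle → X} {U : Set M} :
    ContMDiffOn (I.prod (𝓡 1)) J ∞ f (U ×ˢ univ) ↔
      ContMDiffOn (I.prod 𝓘(ℝ, ℝ)) J ∞ (fun p : M × ℝ => f (p.1, Circle.exp p.2))
        (U ×ˢ univ) := by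
  constructor
  · intro h
    exact h.comp (contMDiff_fst.prodMk (contMDiff_circleExp.comp contMDiff_snd)).contMDiffOn
      fun p hp => ⟨hp.1, mem_univ _⟩
  · rintro h ⟨x, z⟩ hx
    obtain ⟨a, ha, ha'⟩ := exists_smooth_angle z
    have h1 : ContMDiffWithinAt (I.prod (𝓡 1)) (I.prod 𝓘(ℝ, ℝ)) ∞
        (fun q : M × Circle => (q.1, a q.2)) (U ×ˢ univ) (x, z) :=
      (contMDiffAt_fst.prodMk (ha'.comp (x, z) contMDiffAt_snd)).contMDiffWithinAt
    have h2 := (h (x, a z) ⟨hx.1, mem_univ _⟩).comp (x, z) h1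
      (fun q (hq : q ∈ U ×ˢ (univ : Set Circle)) => (⟨hq.1, mem_univ _⟩ : q.1 ∈ U ∧ a q.2 ∈ univ))
    refine h2.congr (fun q _ => ?_) ?_ <;> simp [ha]

theorem contMDiffOn_slice {N : Type*} {EN HN : Type*} [NormedAddCommGroup EN] [NormedSpace ℝ EN]
    [TopologicalSpace HN] {I' : ModelWithCorners ℝ EN HN} [TopologicalSpace N]
    [ChartedSpace HN N] {f : M × N → X} {U : Set M}
    (hf : ContMDiffOn (I.prod I') J ∞ f (U ×ˢ univ)) {x : M} (hx : x ∈ U) :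
    ContMDiff I' J ∞ fun z => f (x, z) :=
  contMDiffOn_univ.1 (hf.comp (contMDiff_const.prodMk contMDiff_id).contMDiffOn
    fun _ _ => ⟨hx, mem_univ _⟩)

end Descent

/-! ### Smooth maps into the loop group -/

section Loops

/-- The exponential law for the Fréchet space `C^∞(S¹, V)`. The hypothesis `hw` says that `w` does
take values in this space; it makes the iterated derivatives in `FrechetSmoothOn` meaningful. -/
theorem frechetSmoothOn_iff {V : Type} [NormedAddCommGroup V] [NormedSpace ℝ V] {M : Man.{u}}
    {w : M → Circle → V} {U : Set M} (hU : IsOpen U)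
    (hw : ∀ x ∈ U, ContMDiff (𝓡 1) 𝓘(ℝ, V) ∞ (w x)) :
    FrechetSmoothOn w U ↔
      ContMDiffOn ((𝓡 M.dim).prod (𝓡 1)) 𝓘(ℝ, V) ∞ (fun p : M × Circle => w p.1 p.2)
        (U ×ˢ univ) := by
  have hopen : ∀ x₀ : M, IsOpen ((extChartAt (𝓡 M.dim) x₀).target ∩
      (extChartAt (𝓡 M.dim) x₀).symm ⁻¹' U) := fun x₀ =>
    (continuousOn_extChartAt_symm x₀).isOpen_inter_preimage (isOpen_extChartAt_target x₀) hU
  have hsmooth : ∀ x ∈ U, ContDiff ℝ ∞ fun s => w x (Circle.exp s) := fun x hx =>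
    ((hw x hx).comp contMDiff_circleExp).contDiff
  have hsymm : ∀ x₀ : M, ContMDiffOn 𝓘(ℝ, EuclideanSpace ℝ (Fin M.dim)) (𝓡 M.dim) ∞
      (extChartAt (𝓡 M.dim) x₀).symm ((extChartAt (𝓡 M.dim) x₀).target ∩
      (extChartAt (𝓡 M.dim) x₀).symm ⁻¹' U) := fun x₀ =>
    (contMDiffOn_extChartAt_symm x₀).mono inter_subset_left
  constructor
  · intro h
    choose H hH hHs using h
    rw [contMDiffOn_prod_circle_iff]
    -- Both directions are local in the base, and a chart reduces them to the Euclidean case.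
    rintro ⟨x₀, t₀⟩ ⟨hx₀ : x₀ ∈ U, -⟩
    set e := extChartAt (𝓡 M.dim) x₀ with he
    have h1 : ∀ j, ContDiffOn ℝ ∞ (fun y => H j (e.symm y)) (e.target ∩ e.symm ⁻¹' U) := fun j =>
      ((hHs j).comp (hsymm x₀) fun y hy => hy.2).contDiffOn
    have h2 : ContDiffOn ℝ ∞ (fun p : EuclideanSpace ℝ (Fin M.dim) × ℝ =>
        H 0 (e.symm p.1) (Circle.exp p.2)) ((e.target ∩ e.symm ⁻¹' U) ×ˢ univ) := by
      rw [contDiffOn_infty]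
      intro n
      refine contDiffOn_uncurry_of_family (hopen x₀) n (fun j y => H j (e.symm y)) h1
        (fun j y hy t => ?_) 0
      have h3 : (fun s => H j (e.symm y) (Circle.exp s)) =
          iteratedDeriv j (fun s => w (e.symm y) (Circle.exp s)) := funext (hH j _ hy.2)
      rw [hH (j + 1) _ hy.2, h3, iteratedDeriv_succ]
      refine DifferentiableAt.hasDerivAt ?_
      exact ((hsmooth _ hy.2).differentiable_iteratedDeriv j (by exact_mod_cast ENat.natCast_lt_top j)) t
    have h4 : ContMDiffAt ((𝓡 M.dim).prod 𝓘(ℝ, ℝ))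
        𝓘(ℝ, EuclideanSpace ℝ (Fin M.dim) × ℝ) ∞
        (fun p : M × ℝ => (e p.1, p.2)) (x₀, t₀) := by
      rw [modelWithCornersSelf_prod, ← chartedSpaceSelf_prod]
      exact (contMDiffAt_extChartAt.comp (x₀, t₀) contMDiffAt_fst).prodMk contMDiffAt_snd
    have h5 : (e x₀, t₀) ∈ (e.target ∩ e.symm ⁻¹' U) ×ˢ (univ : Set ℝ) :=
      ⟨⟨mem_extChartAt_target x₀, by simpa [he] using hx₀⟩, mem_univ _⟩
    have h6 := ((h2.contMDiffOn _ h5).contMDiffAt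
      (((hopen x₀).prod isOpen_univ).mem_nhds h5)).comp (x₀, t₀) h4
    refine (h6.congr_of_eventuallyEq ?_).contMDiffWithinAt
    have h7 : U ∩ e.source ∈ 𝓝 x₀ :=
      inter_mem (hU.mem_nhds hx₀) (extChartAt_source_mem_nhds x₀)
    filter_upwards [prod_mem_nhds h7 univ_mem] with p hp
    have h8 := hH 0 p.1 hp.1.1 p.2
    simp only [Function.comp_apply, e.left_inv hp.1.2, h8, iteratedDeriv_zero]
  · intro h j
    rw [contMDiffOn_prod_circle_iff] at h
    have hex : ∀ x : M, ∃ K : C(Circle, V), x ∈ U → ∀ t : ℝ, K (Circle.exp t) =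
        iteratedDeriv j (fun s : ℝ => w x (Circle.exp s)) t := by
      intro x
      by_cases hx : x ∈ U
      · obtain ⟨K, hK⟩ := exists_continuousMap_circle
          ((hsmooth x hx).continuous_iteratedDeriv j (by exact_mod_cast le_top)) (by
          intro s t hst
          obtain ⟨m, rfl⟩ := Circle.exp_eq_exp.1 hst
          have hper : (fun s => w x (Circle.exp (s + m * (2 * Real.pi)))) =
              fun s => w x (Circle.exp s) := by
            funext s
            rw [Circle.exp_eq_exp.2 ⟨m, rfl⟩]
          have hit := congrFun (iteratedDeriv_comp_add_const j
            (fun s => w x (Circle.exp s)) (m * (2 * Real.pi))) t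
          rw [hper] at hit
          exact hit.symm)
        exact ⟨K, fun _ => hK⟩
      · exact ⟨0, fun h => absurd h hx⟩
    choose H hH using hex
    refine ⟨H, hH, fun x₀ hx₀ => ?_⟩
    set e := extChartAt (𝓡 M.dim) x₀ with he
    have h1 : ContDiffOn ℝ ∞ (fun p : EuclideanSpace ℝ (Fin M.dim) × ℝ =>
        w (e.symm p.1) (Circle.exp p.2)) ((e.target ∩ e.symm ⁻¹' U) ×ˢ univ) := by
      have h0 : ContMDiffOn (𝓘(ℝ, EuclideanSpace ℝ (Fin M.dim)).prod 𝓘(ℝ, ℝ))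
          ((𝓡 M.dim).prod 𝓘(ℝ, ℝ)) ∞
          (fun p : EuclideanSpace ℝ (Fin M.dim) × ℝ => (e.symm p.1, p.2))
          ((e.target ∩ e.symm ⁻¹' U) ×ˢ univ) :=
        ((hsymm x₀).comp contMDiffOn_fst fun p hp => hp.1).prodMk contMDiffOn_snd
      have h01 := h.comp h0 fun p hp => ⟨hp.1.2, mem_univ _⟩
      rw [← contMDiffOn_iff_contDiffOn, modelWithCornersSelf_prod, ← chartedSpaceSelf_prod]
      exact h01
    have h2 := contDiffOn_iteratedDeriv_snd (hopen x₀) h1 j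
    have h3 : ContDiffOn ℝ ∞ (fun y => H (e.symm y)) (e.target ∩ e.symm ⁻¹' U) := by
      rw [contDiffOn_infty]
      intro n
      exact contDiffOn_continuousMap_circle (hopen x₀) n _ _ h2 fun y hy t => hH _ hy.2 t
    have h5 : e x₀ ∈ e.target ∩ e.symm ⁻¹' U :=
      ⟨mem_extChartAt_target x₀, by simpa [he] using hx₀⟩
    have h6 := ((h3.contMDiffOn _ h5).contMDiffAt ((hopen x₀).mem_nhds h5)).comp x₀
      contMDiffAt_extChartAt
    refine (h6.congr_of_eventuallyEq ?_).contMDiffWithinAt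
    filter_upwards [extChartAt_source_mem_nhds (I := 𝓡 M.dim) x₀] with x hx
    simp only [Function.comp_apply, e.left_inv hx]

variable {k : ℕ} {G : Type u} [TopologicalSpace G] [ChartedSpace (EuclideanSpace ℝ (Fin k)) G]
  [Group G] [LieGroup (𝓡 k) ∞ G]

/-- The exponential law for the loop group: a map into `ΩG` is smooth if and only if it is smooth
as a function of two variables. -/
theorem loopSmoothOn_iff {M : Man.{u}} {h : M → LoopGroup k G} {U : Set M} (hU : IsOpen U) :
    LoopSmoothOn k G h U ↔
      ContMDiffOn ((𝓡 M.dim).prod (𝓡 1)) (𝓡 k) ∞ (fun p : M × Circle => (h p.1).1 p.2)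
        (U ×ˢ univ) := by
  have : IsTopologicalGroup G := topologicalGroup_of_lieGroup (𝓡 k) ∞
  set φ := chartAt (EuclideanSpace ℝ (Fin k)) (1 : G) with hφ
  have hφs : ContMDiffOn (𝓡 k) 𝓘(ℝ, EuclideanSpace ℝ (Fin k)) ∞ φ φ.source := contMDiffOn_chart
  have hφt : ContMDiffOn 𝓘(ℝ, EuclideanSpace ℝ (Fin k)) (𝓡 k) ∞ φ.symm φ.target :=
    contMDiffOn_chart_symm
  have loop : ∀ x₀ x : M, (∀ θ, ((h x₀).1 θ)⁻¹ * (h x).1 θ ∈ φ.source) →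
      ContMDiff (𝓡 1) 𝓘(ℝ, EuclideanSpace ℝ (Fin k)) ∞
        fun θ => φ (((h x₀).1 θ)⁻¹ * (h x).1 θ) := fun x₀ x hx =>
    contMDiffOn_univ.1 (hφs.comp ((h x₀).2.1.inv.mul (h x).2.1).contMDiffOn fun θ _ => hx θ)
  constructor
  · rintro hs ⟨x₀, θ₀⟩ ⟨hx₀ : x₀ ∈ U, -⟩
    obtain ⟨W, hW, hxW, -, hsrc, hF⟩ := hs x₀ hx₀
    rw [frechetSmoothOn_iff hW fun x hx => loop x₀ x (hsrc x hx)] at hF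
    have h1 : ContMDiffOn ((𝓡 M.dim).prod (𝓡 1)) (𝓡 k) ∞ (fun p : M × Circle =>
        (h x₀).1 p.2 * φ.symm (φ (((h x₀).1 p.2)⁻¹ * (h p.1).1 p.2))) (W ×ˢ univ) :=
      ((h x₀).2.1.comp contMDiff_snd).contMDiffOn.mul
        (hφt.comp hF fun p hp => φ.map_source (hsrc _ hp.1 _))
    have h2 : W ×ˢ (univ : Set Circle) ∈ 𝓝 (x₀, θ₀) :=
      (hW.prod isOpen_univ).mem_nhds ⟨hxW, mem_univ _⟩
    refine ((h1.contMDiffAt h2).congr_of_eventuallyEq ?_).contMDiffWithinAt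
    filter_upwards [h2] with p hp
    rw [φ.left_inv (hsrc _ hp.1 _), mul_inv_cancel_left]
  · intro hs x₀ hx₀
    have h1 : ContMDiffOn ((𝓡 M.dim).prod (𝓡 1)) (𝓡 k) ∞ (fun p : M × Circle =>
        ((h x₀).1 p.2)⁻¹ * (h p.1).1 p.2) (U ×ˢ univ) :=
      ((h x₀).2.1.comp contMDiff_snd).inv.contMDiffOn.mul hs
    have h2 : IsOpen (U ×ˢ (univ : Set Circle) ∩
        (fun p : M × Circle => ((h x₀).1 p.2)⁻¹ * (h p.1).1 p.2) ⁻¹' φ.source) :=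
      h1.continuousOn.isOpen_inter_preimage (hU.prod isOpen_univ) φ.open_source
    obtain ⟨W, T, hW, -, hxW, hT, hWT⟩ := generalized_tube_lemma (isCompact_singleton (x := x₀))
      (isCompact_univ (X := Circle)) h2 (by
      rintro ⟨x, θ⟩ ⟨rfl, -⟩
      exact ⟨⟨hx₀, mem_univ _⟩, by simp [hφ]⟩)
    have hWU : ∀ x ∈ W, ∀ θ, (x, θ) ∈ U ×ˢ (univ : Set Circle) ∩
        (fun p : M × Circle => ((h x₀).1 p.2)⁻¹ * (h p.1).1 p.2) ⁻¹' φ.source :=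
      fun x hx θ => hWT ⟨hx, hT (mem_univ θ)⟩
    refine ⟨W, hW, hxW rfl, fun x hx => (hWU x hx 1).1.1, fun x hx θ => (hWU x hx θ).2, ?_⟩
    rw [frechetSmoothOn_iff hW fun x hx => loop x₀ x fun θ => (hWU x hx θ).2]
    exact hφs.comp (h1.mono (prod_mono_left fun x hx => (hWU x hx 1).1.1))
      fun p hp => (hWU p.1 hp.1 p.2).2

end Loops

/-! ### Gluing a manifold from smooth transition maps -/

/-- A set that is covered by partial bijections with a manifold `B`, with open domains of definition
and smooth transition maps, is a manifold for which these bijections are diffeomorphisms. -/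
theorem exists_isManifold_of_transitions {E H X B ι : Type*} [NormedAddCommGroup E]
    [NormedSpace ℝ E] [TopologicalSpace H] {I : ModelWithCorners ℝ E H} [TopologicalSpace B]
    [ChartedSpace H B] [IsManifold I ∞ B] (φ : ι → PartialEquiv X B)
    (hcover : ∀ x, ∃ i, x ∈ (φ i).source)
    (hopen : ∀ i j, IsOpen ((φ i).symm.trans (φ j)).source)
    (hsmooth : ∀ i j, ContMDiffOn I I ∞ ((φ i).symm.trans (φ j))
      ((φ i).symm.trans (φ j)).source) :
    ∃ (_ : TopologicalSpace X) (_ : ChartedSpace H X), IsManifold I ∞ X ∧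
      ∀ i, IsOpen (φ i).source ∧ ContMDiffOn I I ∞ (φ i) (φ i).source ∧
        ContMDiffOn I I ∞ (φ i).symm (φ i).target := by
  choose ix hix using hcover
  let core : ChartedSpaceCore B X :=
    { atlas := range φ
      chartAt := fun x => φ (ix x)
      mem_chart_source := hix
      chart_mem_atlas := fun x => ⟨_, rfl⟩
      open_source := by
        rintro _ _ ⟨i, rfl⟩ ⟨j, rfl⟩
        exact hopen i j
      continuousOn_toFun := by
        rintro _ _ ⟨i, rfl⟩ ⟨j, rfl⟩
        exact (hsmooth i j).continuousOn }
  let : TopologicalSpace X := core.toTopologicalSpace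
  let cB : ChartedSpace B X := core.toChartedSpace
  let cH : ChartedSpace H X := ChartedSpace.comp H B X
  let Φ : ι → OpenPartialHomeomorph X B := fun i => core.openPartialHomeomorph (φ i) ⟨i, rfl⟩
  have hτ : ∀ i j, ContMDiffOn I I ∞ ((Φ i).symm ≫ₕ Φ j) ((Φ i).symm ≫ₕ Φ j).source := hsmooth
  have hτat : ∀ i j x, x ∈ (Φ i).source → x ∈ (Φ j).source →
      ContMDiffAt I I ∞ ((Φ i).symm ≫ₕ Φ j) (Φ i x) := by
    intro i j x hi hj
    have hx : Φ i x ∈ ((Φ i).symm ≫ₕ Φ j).source :=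
      ⟨(Φ i).map_source hi, show (Φ i).symm (Φ i x) ∈ (Φ j).source by rwa [(Φ i).left_inv hi]⟩
    exact (hτ i j).contMDiffAt (((Φ i).symm ≫ₕ Φ j).open_source.mem_nhds hx)
  have hman : IsManifold I ∞ X := by
    refine isManifold_of_contDiffOn I ∞ X ?_
    have hatlas : ∀ e ∈ cB.atlas, ∃ i, e = Φ i := by
      intro e he
      obtain ⟨_, ⟨i, rfl⟩, h⟩ := mem_iUnion₂.1 he
      exact ⟨i, h⟩
    rintro _ _ ⟨_, he, f, hf, rfl⟩ ⟨_, he', f', hf', rfl⟩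
    obtain ⟨i, rfl⟩ := hatlas _ he
    obtain ⟨j, rfl⟩ := hatlas _ he'
    have hfm := IsManifold.subset_maximalAtlas (I := I) (n := ∞) hf
    have hfm' := IsManifold.subset_maximalAtlas (I := I) (n := ∞) hf'
    have h1 : ContMDiffOn I I ∞ ((Φ i ≫ₕ f).symm ≫ₕ (Φ j ≫ₕ f'))
        ((Φ i ≫ₕ f).symm ≫ₕ (Φ j ≫ₕ f')).source := by
      intro y hy
      simp only [mfld_simps] at hy
      have a1 := contMDiffAt_symm_of_mem_maximalAtlas hfm hy.1.1
      have a2 := hτat i j ((Φ i).symm (f.symm y)) ((Φ i).map_target hy.1.2) hy.2.1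
      rw [(Φ i).right_inv hy.1.2] at a2
      have a3 : ContMDiffAt I I ∞ f' (((Φ i).symm ≫ₕ Φ j) (f.symm y)) :=
        contMDiffAt_of_mem_maximalAtlas hfm' hy.2.2
      exact ((a3.comp _ a2).comp y a1).contMDiffWithinAt
    have h2 := (I.contMDiff (n := ∞)).comp_contMDiffOn
      (h1.comp (I.contMDiffOn_symm.mono inter_subset_right)
        (fun y (hy : y ∈ I.symm ⁻¹' ((Φ i ≫ₕ f).symm ≫ₕ (Φ j ≫ₕ f')).source ∩ range I) => hy.1))
    exact h2.contDiffOn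
  refine ⟨inferInstance, cH, hman, fun i => ⟨(Φ i).open_source, ?_, ?_⟩⟩
  · change ContMDiffOn I I ∞ (Φ i) (Φ i).source
    intro x hx
    let j := ix x
    have hj : x ∈ (Φ j).source := hix x
    let f := chartAt H (Φ j x)
    have a1 : ContMDiffAt I I ∞ (Φ j ≫ₕ f) x :=
      contMDiffAt_of_mem_maximalAtlas (IsManifold.chart_mem_maximalAtlas x) (mem_chart_source H x)
    have a2 : ContMDiffAt I I ∞ f.symm ((Φ j ≫ₕ f) x) :=
      contMDiffAt_symm_of_mem_maximalAtlas (IsManifold.chart_mem_maximalAtlas _)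
        (mem_chart_target H (Φ j x))
    have a3 := hτat j i x hj hx
    have hfx : f.symm ((Φ j ≫ₕ f) x) = Φ j x := f.left_inv (mem_chart_source H (Φ j x))
    rw [← hfx] at a3
    refine ((a3.comp x (a2.comp x a1)).congr_of_eventuallyEq ?_).contMDiffWithinAt
    filter_upwards [(Φ j ≫ₕ f).open_source.mem_nhds (mem_chart_source H x)] with y hy
    simp only [mfld_simps] at hy
    simp only [mfld_simps, f.left_inv hy.2, (Φ j).left_inv hy.1]
  · change ContMDiffOn I I ∞ (Φ i).symm (Φ i).target
    intro b hb
    let x := (Φ i).symm b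
    have hxi : x ∈ (Φ i).source := (Φ i).map_target hb
    let j := ix x
    have hj : x ∈ (Φ j).source := hix x
    let f := chartAt H (Φ j x)
    have a1 : ContMDiffAt I I ∞ (Φ j ≫ₕ f).symm ((Φ j ≫ₕ f) x) :=
      contMDiffAt_symm_of_mem_maximalAtlas (IsManifold.chart_mem_maximalAtlas x)
        (mem_chart_target H x)
    have a2 : ContMDiffAt I I ∞ f (Φ j x) :=
      contMDiffAt_of_mem_maximalAtlas (IsManifold.chart_mem_maximalAtlas _)
        (mem_chart_source H (Φ j x))
    have a3 := hτat i j x hxi hj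
    have hxb : Φ i x = b := (Φ i).right_inv hb
    rw [hxb] at a3
    have hjb : ((Φ i).symm ≫ₕ Φ j) b = Φ j x := rfl
    rw [← hjb] at a2
    have a1' : ContMDiffAt I I ∞ (Φ j ≫ₕ f).symm ((f ∘ ((Φ i).symm ≫ₕ Φ j)) b) := a1
    refine ((a1'.comp b (a2.comp b a3)).congr_of_eventuallyEq ?_).contMDiffWithinAt
    have hs : b ∈ ((Φ i).symm ≫ₕ (Φ j ≫ₕ f)).source := by
      simp only [mfld_simps]
      exact ⟨hb, hj, mem_chart_source H (Φ j x)⟩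
    filter_upwards [((Φ i).symm ≫ₕ (Φ j ≫ₕ f)).open_source.mem_nhds hs] with y hy
    simp only [mfld_simps] at hy
    simp only [mfld_simps, f.left_inv hy.2.2, (Φ j).left_inv hy.2.1]

variable {k : ℕ} {G : Type u} [TopologicalSpace G] [ChartedSpace (EuclideanSpace ℝ (Fin k)) G]
  [Group G] [LieGroup (𝓡 k) ∞ G]

/-! ### Smooth maps into `ΩG`-bundles -/

namespace LoopBundle

variable {M : Man.{u}} (P : LoopBundle k G M)

theorem act_injective (p : P.total) : Function.Injective (P.act p) := by
  intro γ δ h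
  have h1 : P.act p (γ * δ⁻¹) = p := by
    rw [P.act_mul, h, ← P.act_mul, mul_inv_cancel, P.act_one]
  exact mul_inv_eq_one.1 (P.free p _ h1)

variable {P} {N : Man.{u}}

/-- Smoothness of a map into an `ΩG`-bundle in terms of functions of two variables. -/
theorem smoothOn_iff {c : N → P.total} {V : Set N} (hV : IsOpen V) :
    P.SmoothOn c V ↔ ContMDiffOn (𝓡 N.dim) (𝓡 M.dim) ∞ (fun y => P.proj (c y)) V ∧
      ∀ s ∈ P.atlas, ∃ h : N → LoopGroup k G,
        ContMDiffOn ((𝓡 N.dim).prod (𝓡 1)) (𝓡 k) ∞ (fun p : N × Circle => (h p.1).1 p.2)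
          ((V ∩ (fun y => P.proj (c y)) ⁻¹' s.1) ×ˢ univ) ∧
        ∀ y ∈ V ∩ (fun y => P.proj (c y)) ⁻¹' s.1, c y = P.act (s.2 (P.proj (c y))) (h y) := by
  refine and_congr_right fun hp => forall₂_congr fun s hs => exists_congr fun h => ?_
  rw [loopSmoothOn_iff (hp.continuousOn.isOpen_inter_preimage hV (P.isOpen_atlas s hs))]

theorem SmoothOn.comp {c : M → P.total} {U : Set M} (hU : IsOpen U) (hc : P.SmoothOn c U)
    {f : N → M} {V : Set N} (hV : IsOpen V) (hf : ContMDiffOn (𝓡 N.dim) (𝓡 M.dim) ∞ f V)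
    (hfU : MapsTo f V U) : P.SmoothOn (fun y => c (f y)) V := by
  rw [smoothOn_iff hU] at hc
  rw [smoothOn_iff hV]
  refine ⟨hc.1.comp hf hfU, fun s hs => ?_⟩
  obtain ⟨h, hh, hch⟩ := hc.2 s hs
  refine ⟨fun y => h (f y), ?_, fun y hy => hch (f y) ⟨hfU hy.1, hy.2⟩⟩
  exact hh.comp (((hf.mono inter_subset_left).comp contMDiffOn_fst fun p hp => hp.1).prodMk
    contMDiffOn_snd) fun p hp => ⟨⟨hfU hp.1.1, hp.1.2⟩, mem_univ _⟩

theorem smoothOn_section {s : Set M × (M → P.total)} (hs : s ∈ P.atlas) :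
    P.SmoothOn s.2 s.1 := by
  have hset : ∀ t : Set M, s.1 ∩ (fun y => P.proj (s.2 y)) ⁻¹' t = s.1 ∩ t := by
    intro t
    ext x
    exact and_congr_right fun hx => by simp [P.section_atlas s hs x hx]
  refine ⟨contMDiffOn_id.congr (P.section_atlas s hs), fun t ht => ?_⟩
  obtain ⟨h, hh, hst⟩ := P.compatible t ht s hs
  refine ⟨h, by rwa [hset, inter_comm], fun x hx => ?_⟩
  rw [hset] at hx
  rw [P.section_atlas s hs x hx.1]
  exact hst x hx.symm

theorem smoothOn_const (p : P.total) : P.SmoothOn (fun _ : N => p) univ := by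
  rw [smoothOn_iff isOpen_univ]
  refine ⟨contMDiffOn_const, fun s hs => ?_⟩
  by_cases h : P.proj p ∈ s.1
  · obtain ⟨γ, hγ⟩ := P.transitive (s.2 (P.proj p)) p (P.section_atlas s hs _ h)
    exact ⟨fun _ => γ, (γ.2.1.comp contMDiff_snd).contMDiffOn, fun _ _ => hγ⟩
  · refine ⟨fun _ => 1, contMDiffOn_const, fun y hy => absurd hy.2 h⟩

/-- The `ΩG`-valued difference of two smooth maps into the same fibres is smooth. -/
theorem SmoothOn.contMDiffOn_div {c c' : N → P.total} {V : Set N} (hV : IsOpen V)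
    (hc : P.SmoothOn c V) (hc' : P.SmoothOn c' V) {h : N → LoopGroup k G}
    (hh : ∀ y ∈ V, c' y = P.act (c y) (h y)) :
    ContMDiffOn ((𝓡 N.dim).prod (𝓡 1)) (𝓡 k) ∞ (fun p : N × Circle => (h p.1).1 p.2)
      (V ×ˢ univ) := by
  rw [smoothOn_iff hV] at hc hc'
  rintro ⟨y, θ⟩ ⟨hy : y ∈ V, -⟩
  obtain ⟨s, hs, hys⟩ := P.cover (P.proj (c y))
  obtain ⟨a, ha, hca⟩ := hc.2 s hs
  obtain ⟨b, hb, hcb⟩ := hc'.2 s hs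
  have hproj : ∀ y ∈ V, P.proj (c' y) = P.proj (c y) := fun y hy => by rw [hh y hy, P.proj_act]
  have hsub : V ∩ (fun y => P.proj (c' y)) ⁻¹' s.1 = V ∩ (fun y => P.proj (c y)) ⁻¹' s.1 := by
    ext y
    exact and_congr_right fun hy => by simp [hproj y hy]
  rw [hsub] at hb hcb
  have hopen : IsOpen (V ∩ (fun y => P.proj (c y)) ⁻¹' s.1) :=
    hc.1.continuousOn.isOpen_inter_preimage hV (P.isOpen_atlas s hs)
  have hmem : (V ∩ (fun y => P.proj (c y)) ⁻¹' s.1) ×ˢ (univ : Set Circle) ∈ 𝓝 (y, θ) :=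
    (hopen.prod isOpen_univ).mem_nhds ⟨⟨hy, hys⟩, mem_univ _⟩
  have heq : ∀ y ∈ V ∩ (fun y => P.proj (c y)) ⁻¹' s.1, h y = (a y)⁻¹ * b y := by
    intro y hy
    have h1 := hcb y hy
    rw [hh y hy.1, P.proj_act] at h1
    conv_lhs at h1 => rw [hca y hy]
    rw [← P.act_mul] at h1
    rw [← P.act_injective _ h1, inv_mul_cancel_left]
  refine (((ha.inv.mul hb).congr fun p hp => ?_).contMDiffAt hmem).contMDiffWithinAt
  rw [heq _ hp.1]
  rfl

end LoopBundle

/-- An `ΩG`-bundle map over the identity is an isomorphism. -/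
theorem LoopBundle.exists_iso {M : Man.{u}} {P P' : LoopBundle k G M}
    (φ : (⟨M, P⟩ : Bun k G) ⟶ ⟨M, P'⟩) (hφ : φ.base = 𝟙 M) :
    ∃ i : (⟨M, P⟩ : Bun k G) ≅ ⟨M, P'⟩, i.hom = φ := by
  have hproj : ∀ p : P.total, P'.proj (φ.total p) = P.proj p := fun p => by
    have := φ.proj_total p
    rwa [hφ] at this
  have hact : ∀ p γ, φ.total (P.act p γ) = P'.act (φ.total p) γ := φ.total_act
  have hinj : Function.Injective φ.total := by
    intro (p : P.total) (q : P.total) h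
    obtain ⟨γ, rfl⟩ := P.transitive p q (by rw [← hproj, ← hproj, h])
    rw [hact] at h
    rw [P'.free _ _ h.symm, P.act_one]
  have hsurj : Function.Surjective φ.total := by
    intro (q : P'.total)
    obtain ⟨s, hs, hq⟩ := P.cover (P'.proj q)
    obtain ⟨γ, hγ⟩ := P'.transitive (φ.total (s.2 (P'.proj q))) q (by
      rw [hproj, P.section_atlas s hs _ hq])
    exact ⟨P.act (s.2 (P'.proj q)) γ, by rw [hact, ← hγ]⟩
  obtain ⟨ψ, hψl, hψr⟩ := Function.bijective_iff_has_inverse.1 ⟨hinj, hsurj⟩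
  have hψproj : ∀ q : P'.total, P.proj (ψ q) = P'.proj q := fun q => by rw [← hproj, hψr q]
  refine ⟨⟨φ, ⟨𝟙 M, ψ, hψproj, fun q γ => hinj ?_, ?_⟩, ?_, ?_⟩, rfl⟩
  · change φ.total (ψ (P'.act q γ)) = φ.total (P.act (ψ q) γ)
    rw [hact, hψr, hψr]
  · intro N c V hV hc
    change P'.SmoothOn c V at hc
    change P.SmoothOn (fun y => ψ (c y)) V
    rw [smoothOn_iff hV]
    refine ⟨hc.1.congr fun y _ => hψproj _, fun s hs => ?_⟩
    have hset : (fun y => P.proj (ψ (c y))) ⁻¹' s.1 = (fun y => P'.proj (c y)) ⁻¹' s.1 := by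
      ext y
      simp [hψproj]
    have hopen : IsOpen (V ∩ (fun y => P'.proj (c y)) ⁻¹' s.1) :=
      hc.1.continuousOn.isOpen_inter_preimage hV (P.isOpen_atlas s hs)
    have hex : ∀ y, ∃ γ : LoopGroup k G, P.proj (ψ (c y)) ∈ s.1 →
        ψ (c y) = P.act (s.2 (P.proj (ψ (c y)))) γ := by
      intro y
      by_cases hy : P.proj (ψ (c y)) ∈ s.1
      · obtain ⟨γ, hγ⟩ := P.transitive _ (ψ (c y)) (P.section_atlas s hs _ hy)
        exact ⟨γ, fun _ => hγ⟩
      · exact ⟨1, fun h => absurd h hy⟩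
    choose h hh using hex
    refine ⟨h, ?_, fun y hy => hh y hy.2⟩
    rw [hset]
    -- Both `c` and `φ ∘ σ` are smooth maps into `P'`, and `h` is their difference.
    have h1 : P'.SmoothOn (fun x => φ.total (s.2 x)) s.1 :=
      φ.smooth M s.2 s.1 (P.isOpen_atlas s hs) (smoothOn_section hs)
    have h2 := h1.comp (P.isOpen_atlas s hs) hopen (hc.1.mono inter_subset_left)
      fun y hy => hy.2
    have h3 : P'.SmoothOn c (V ∩ (fun y => P'.proj (c y)) ⁻¹' s.1) := by
      rw [smoothOn_iff hV] at hc
      rw [smoothOn_iff hopen]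
      refine ⟨hc.1.mono inter_subset_left, fun t ht => ?_⟩
      obtain ⟨a, ha, ha'⟩ := hc.2 t ht
      exact ⟨a, ha.mono (prod_mono_left (inter_subset_inter_left _ inter_subset_left)),
        fun y hy => ha' y ⟨hy.1.1, hy.2⟩⟩
    refine h2.contMDiffOn_div hopen h3 fun y hy => ?_
    have h4 := congrArg φ.total (hh y (by rw [hψproj]; exact hy.2))
    rwa [hψr, hact, hψproj] at h4
  · exact Bun.Hom.ext (by change φ.base ≫ 𝟙 M = 𝟙 M; rw [hφ]; rfl) (funext hψl)
  · exact Bun.Hom.ext (by change 𝟙 M ≫ φ.base = 𝟙 M; rw [hφ]; rfl) (funext hψr)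

/-! ### Smooth maps out of framed bundles -/

namespace FramedBundle

variable {M : Man.{u}} (Q : FramedBundle k G M)

theorem transitive {p q : Q.total} (h : Q.proj p = Q.proj q) : ∃ g, q = Q.act p g := by
  obtain ⟨U, -, hp, ψ, σ, -, -, -, hσψ, -⟩ := Q.locally_trivial (Q.proj p)
  refine ⟨(ψ p)⁻¹ * ψ q, ?_⟩
  have h1 := hσψ p hp
  have h2 := hσψ q (by rwa [mem_preimage, ← h])
  rw [← h] at h2
  calc q = Q.act (Q.act (σ (Q.proj p)) (ψ p)) ((ψ p)⁻¹ * ψ q) := by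
        rw [← Q.act_mul, mul_inv_cancel_left, h2]
    _ = Q.act p ((ψ p)⁻¹ * ψ q) := by rw [h1]

theorem act_injective (p : Q.total) : Function.Injective (Q.act p) := by
  intro g h hgh
  obtain ⟨U, -, hp, ψ, σ, -, -, -, hσψ, hψ⟩ := Q.locally_trivial (Q.proj p)
  have h1 : ∀ g, ψ (Q.act p g) = ψ p * g := fun g => by
    conv_lhs => rw [← hσψ p hp, ← Q.act_mul]
    exact hψ _ hp _
  simpa [h1] using congrArg ψ hgh

section

variable {E H N : Type*} [NormedAddCommGroup E] [NormedSpace ℝ E] [TopologicalSpace H]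
  {I : ModelWithCorners ℝ E H} [TopologicalSpace N] [ChartedSpace H N]

variable {Q}

theorem contMDiffOn_act {f : N → Q.total} {g : N → G} {V : Set N}
    (hf : ContMDiffOn I (totalModel k M.dim) ∞ f V) (hg : ContMDiffOn I (𝓡 k) ∞ g V) :
    ContMDiffOn I (totalModel k M.dim) ∞ (fun y => Q.act (f y) (g y)) V :=
  Q.smooth_act.comp_contMDiffOn (hf.prodMk hg)

/-- The `G`-valued difference of two smooth maps into the same fibres is smooth. -/
theorem contMDiffOn_div {f f' : N → Q.total} {g : N → G} {V : Set N}
    (hf : ContMDiffOn I (totalModel k M.dim) ∞ f V)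
    (hf' : ContMDiffOn I (totalModel k M.dim) ∞ f' V)
    (hg : ∀ y ∈ V, f' y = Q.act (f y) (g y)) : ContMDiffOn I (𝓡 k) ∞ g V := by
  intro y hy
  obtain ⟨U, hU, hyU, ψ, σ, hψs, -, -, hσψ, hψ⟩ := Q.locally_trivial (Q.proj (f y))
  have hψU : ∀ p, Q.proj p ∈ U → ContMDiffAt (totalModel k M.dim) (𝓡 k) ∞ ψ p := fun p hp =>
    hψs.contMDiffAt ((hU.preimage Q.smooth_proj.continuous).mem_nhds hp)
  have hproj : Q.proj (f' y) ∈ U := by rwa [hg y hy, Q.proj_act]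
  have h1 := ((hψU _ hyU).comp_contMDiffWithinAt y (hf y hy)).inv.mul
    ((hψU _ hproj).comp_contMDiffWithinAt y (hf' y hy))
  have heq : ∀ y ∈ V, Q.proj (f y) ∈ U → g y = (ψ (f y))⁻¹ * ψ (f' y) := by
    intro y hy hyU
    have h2 : ψ (f' y) = ψ (f y) * g y := by
      rw [hg y hy]
      conv_lhs => rw [← hσψ _ hyU, ← Q.act_mul]
      exact hψ _ hyU _
    rw [h2, inv_mul_cancel_left]
  refine h1.congr_of_eventuallyEq ?_ (heq y hy hyU)
  have h3 : ∀ᶠ z in 𝓝[V] y, Q.proj (f z) ∈ U :=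
    (Q.smooth_proj.continuous.continuousAt.comp_continuousWithinAt
      (hf y hy).continuousWithinAt).eventually (hU.mem_nhds hyU)
  filter_upwards [h3, self_mem_nhdsWithin] with z hz hzV using heq z hzV hz

end

/-- An equivariant map of principal bundles is smooth if it is smooth along local smooth sections
over the sets of an open cover of the base. -/
theorem contMDiff_of_sections {M' : Man.{u}} {Q : FramedBundle k G M} {Q' : FramedBundle k G M'}
    {F : Q.total → Q'.total} (hF : ∀ p g, F (Q.act p g) = Q'.act (F p) g)
    (hsec : ∀ y : M × Circle, ∃ (U : Set (M × Circle)) (σ : M × Circle → Q.total),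
      IsOpen U ∧ y ∈ U ∧ (∀ z ∈ U, Q.proj (σ z) = z) ∧
      ContMDiffOn ((𝓡 M.dim).prod (𝓡 1)) (totalModel k M.dim) ∞ σ U ∧
      ContMDiffOn ((𝓡 M.dim).prod (𝓡 1)) (totalModel k M'.dim) ∞ (fun z => F (σ z)) U) :
    ContMDiff (totalModel k M.dim) (totalModel k M'.dim) ∞ F := by
  intro p
  obtain ⟨U, σ, hU, hpU, hσ, hσs, hFσ⟩ := hsec (Q.proj p)
  have hV : IsOpen (Q.proj ⁻¹' U) := hU.preimage Q.smooth_proj.continuous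
  have hex : ∀ q, ∃ g, Q.proj q ∈ U → q = Q.act (σ (Q.proj q)) g := by
    intro q
    by_cases hq : Q.proj q ∈ U
    · obtain ⟨g, hg⟩ := Q.transitive (hσ _ hq)
      exact ⟨g, fun _ => hg⟩
    · exact ⟨1, fun h => absurd h hq⟩
  choose g hg using hex
  have h1 : ContMDiffOn (totalModel k M.dim) (totalModel k M.dim) ∞ (fun q => σ (Q.proj q))
      (Q.proj ⁻¹' U) := hσs.comp Q.smooth_proj.contMDiffOn fun q hq => hq
  have h2 : ContMDiffOn (totalModel k M.dim) (𝓡 k) ∞ g (Q.proj ⁻¹' U) :=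
    contMDiffOn_div h1 contMDiffOn_id hg
  have h3 : ContMDiffOn (totalModel k M.dim) (totalModel k M'.dim) ∞
      (fun q => F (σ (Q.proj q))) (Q.proj ⁻¹' U) :=
    hFσ.comp Q.smooth_proj.contMDiffOn fun q hq => hq
  refine ((contMDiffOn_act h3 h2).congr fun q hq => ?_).contMDiffAt (hV.mem_nhds hpU)
  conv_lhs => rw [hg q hq]
  rw [hF]

end FramedBundle

/-- A map of framed bundles over the identity is an isomorphism. -/
theorem FramedBundle.exists_iso {M : Man.{u}} {Q Q' : FramedBundle k G M}
    (φ : (⟨M, Q⟩ : FrBun k G) ⟶ ⟨M, Q'⟩) (hφ : φ.base = 𝟙 M) :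
    ∃ i : (⟨M, Q⟩ : FrBun k G) ≅ ⟨M, Q'⟩, i.hom = φ := by
  have hproj : ∀ p : Q.total, Q'.proj (φ.total p) = Q.proj p := fun p => by
    have := φ.proj_total p
    rwa [hφ] at this
  have hframe : ∀ m, φ.total (Q.frame m) = Q'.frame m := fun m => by
    have := φ.total_frame m
    rwa [hφ] at this
  have hact : ∀ p g, φ.total (Q.act p g) = Q'.act (φ.total p) g := φ.total_act
  have hinj : Function.Injective φ.total := by
    intro (p : Q.total) (q : Q.total) h
    obtain ⟨g, rfl⟩ := Q.transitive (p := p) (q := q) (by rw [← hproj, ← hproj, h])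
    rw [hact] at h
    have h1 := Q'.act_injective (φ.total p) ((Q'.act_one _).trans h)
    rw [← h1, Q.act_one]
  have hsurj : Function.Surjective φ.total := by
    intro (q : Q'.total)
    obtain ⟨U, -, hq, ψ, σ, -, -, hσ, -, -⟩ := Q.locally_trivial (Q'.proj q)
    obtain ⟨g, hg⟩ := Q'.transitive (p := φ.total (σ (Q'.proj q))) (q := q) (by
      rw [hproj, hσ _ hq])
    exact ⟨Q.act (σ (Q'.proj q)) g, by rw [hact, ← hg]⟩
  obtain ⟨ψ, hψl, hψr⟩ := Function.bijective_iff_has_inverse.1 ⟨hinj, hsurj⟩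
  have hψproj : ∀ q : Q'.total, Q.proj (ψ q) = Q'.proj q := fun q => by rw [← hproj, hψr q]
  have hψact : ∀ q g, ψ (Q'.act q g) = Q.act (ψ q) g := fun q g => hinj (by
    rw [hact, hψr, hψr])
  refine ⟨⟨φ, ⟨𝟙 M, ψ, hψproj, hψact, fun m => hinj ?_, ?_⟩, ?_, ?_⟩, rfl⟩
  · change φ.total (ψ (Q'.frame m)) = φ.total (Q.frame m)
    rw [hψr, hframe]
  · refine FramedBundle.contMDiff_of_sections (Q := Q') (Q' := Q) hψact fun y => ?_
    obtain ⟨U, hU, hy, -, σ, -, hσs, hσ, -, -⟩ := Q.locally_trivial y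
    refine ⟨U, fun z => φ.total (σ z), hU, hy, fun z hz => ?_, ?_, ?_⟩
    · rw [hproj, hσ z hz]
    · exact φ.smooth.comp_contMDiffOn hσs
    · exact hσs.congr fun z _ => hψl _
  · exact FrBun.Hom.ext (by change φ.base ≫ 𝟙 M = 𝟙 M; rw [hφ]; rfl) (funext hψl)
  · exact FrBun.Hom.ext (by change 𝟙 M ≫ φ.base = 𝟙 M; rw [hφ]; rfl) (funext hψr)

/-! ### The caloron transform of an `ΩG`-bundle -/

namespace LoopBundle

variable {M : Man.{u}} (P : LoopBundle k G M)

theorem cls_act (p : P.total) (γ : LoopGroup k G) (g : G) (θ : Circle) :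
    P.cls (P.act p γ) g θ = P.cls p (γ.1 θ * g) θ :=
  Quotient.sound (s := P.orbitSetoid) ⟨γ⁻¹, by simp [← P.act_mul, P.act_one]⟩

theorem cls_injective (p : P.total) {g g' : G} {θ : Circle} (h : P.cls p g θ = P.cls p g' θ) :
    g = g' := by
  obtain ⟨γ, hγ⟩ := Quotient.exact (s := P.orbitSetoid) h
  simp only [Prod.mk.injEq] at hγ
  rw [P.free _ _ hγ.1.symm] at hγ
  simpa using hγ.2.1.symm

/-- The projection `[p, g, θ] ↦ (π p, θ)`. -/
def assocProj : P.Assoc → M × Circle :=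
  Quotient.lift (s := P.orbitSetoid) (fun a => (P.proj a.1, a.2.2)) (by
    rintro ⟨p, g, θ⟩ _ ⟨γ, rfl⟩
    simp [P.proj_act])

/-- The action `[p, g, θ] h = [p, g h, θ]` of `G`. -/
def assocAct (a : P.Assoc) (h : G) : P.Assoc :=
  Quotient.map (sa := P.orbitSetoid) (sb := P.orbitSetoid) (fun a => (a.1, a.2.1 * h, a.2.2)) (by
    rintro ⟨p, g, θ⟩ _ ⟨γ, rfl⟩
    exact ⟨γ, by simp [mul_assoc]⟩) a

theorem assocProj_cls (p : P.total) (g : G) (θ : Circle) :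
    P.assocProj (P.cls p g θ) = (P.proj p, θ) := rfl

theorem assocAct_cls (p : P.total) (g h : G) (θ : Circle) :
    P.assocAct (P.cls p g θ) h = P.cls p (g * h) θ := rfl

theorem exists_cls (a : P.Assoc) : ∃ p g θ, a = P.cls p g θ := by
  obtain ⟨⟨p, g, θ⟩, rfl⟩ := Quotient.exists_rep (s := P.orbitSetoid) a
  exact ⟨p, g, θ, rfl⟩

theorem assocProj_act (a : P.Assoc) (h : G) : P.assocProj (P.assocAct a h) = P.assocProj a := by
  obtain ⟨p, g, θ, rfl⟩ := P.exists_cls a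
  rfl

/-- The class `[p, g, θ]` with prescribed `p` in the right fibre. -/
theorem exists_cls_eq {a : P.Assoc} {p : P.total} (h : P.proj p = (P.assocProj a).1) :
    ∃ g, a = P.cls p g (P.assocProj a).2 := by
  obtain ⟨q, g, θ, rfl⟩ := P.exists_cls a
  obtain ⟨γ, rfl⟩ := P.transitive p q h
  exact ⟨_, P.cls_act _ _ _ _⟩

/-- The `G`-component of `a = [σ(x), g, θ]` in the trivialisation given by the local section `σ`;
it is meaningful over the domain of `σ` only. -/
def assocFiber (s : Set M × (M → P.total)) (a : P.Assoc) : G :=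
  Classical.epsilon fun g => a = P.cls (s.2 (P.assocProj a).1) g (P.assocProj a).2

variable {P} {s : Set M × (M → P.total)}

theorem cls_assocFiber (hs : s ∈ P.atlas) {a : P.Assoc} (ha : (P.assocProj a).1 ∈ s.1) :
    a = P.cls (s.2 (P.assocProj a).1) (P.assocFiber s a) (P.assocProj a).2 :=
  Classical.epsilon_spec (P.exists_cls_eq (P.section_atlas s hs _ ha))

theorem assocFiber_cls (hs : s ∈ P.atlas) {x : M} (hx : x ∈ s.1) (g : G) (θ : Circle) :
    P.assocFiber s (P.cls (s.2 x) g θ) = g := by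
  have h := cls_assocFiber hs (a := P.cls (s.2 x) g θ) (by
    rwa [assocProj_cls, P.section_atlas s hs x hx])
  simp only [assocProj_cls, P.section_atlas s hs x hx] at h
  exact (P.cls_injective _ h).symm

variable (P)

/-- The trivialisation `[σ(x), g, θ] ↦ ((x, θ), g)` of `(P × G × S¹)/ΩG` given by a local section
`σ` of `P`. -/
def assocChart (s : P.atlas) : PartialEquiv P.Assoc ((M × Circle) × G) where
  toFun a := (P.assocProj a, P.assocFiber s.1 a)
  invFun z := P.cls (s.1.2 z.1.1) z.2 z.1.2
  source := {a | (P.assocProj a).1 ∈ s.1.1}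
  target := (s.1.1 ×ˢ univ) ×ˢ univ
  map_source' a ha := ⟨⟨ha, mem_univ _⟩, mem_univ _⟩
  map_target' z hz := by
    change P.proj (s.1.2 z.1.1) ∈ s.1.1
    rw [P.section_atlas _ s.2 _ hz.1.1]
    exact hz.1.1
  left_inv' a ha := (cls_assocFiber s.2 ha).symm
  right_inv' z hz := by
    refine Prod.ext ?_ (assocFiber_cls s.2 hz.1.1 _ _)
    change (P.proj (s.1.2 z.1.1), z.1.2) = z.1
    rw [P.section_atlas _ s.2 _ hz.1.1]

theorem assocChart_transition_source (s t : P.atlas) :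
    ((P.assocChart s).symm.trans (P.assocChart t)).source =
      ((s.1.1 ∩ t.1.1) ×ˢ univ) ×ˢ univ := by
  ext z
  change (z ∈ (s.1.1 ×ˢ (univ : Set Circle)) ×ˢ (univ : Set G) ∧
    P.proj (s.1.2 z.1.1) ∈ t.1.1) ↔ _
  simp only [mem_prod, mem_univ, and_true, mem_inter_iff]
  exact and_congr_right fun h => by rw [P.section_atlas _ s.2 _ h]

theorem contMDiffOn_assocChart_transition (s t : P.atlas) :
    ContMDiffOn (totalModel k M.dim) (totalModel k M.dim) ∞
      ((P.assocChart s).symm.trans (P.assocChart t))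
      ((P.assocChart s).symm.trans (P.assocChart t)).source := by
  rw [assocChart_transition_source]
  obtain ⟨h, hh, hst⟩ := P.compatible t.1 t.2 s.1 s.2
  rw [loopSmoothOn_iff ((P.isOpen_atlas _ t.2).inter (P.isOpen_atlas _ s.2))] at hh
  have h1 : ContMDiffOn (totalModel k M.dim) (totalModel k M.dim) ∞
      (fun z : (M × Circle) × G => (z.1, (h z.1.1).1 z.1.2 * z.2))
      (((s.1.1 ∩ t.1.1) ×ˢ univ) ×ˢ univ) :=
    contMDiffOn_fst.prodMk ((hh.comp contMDiffOn_fst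
      fun z hz => ⟨hz.1.1.symm, mem_univ _⟩).mul contMDiffOn_snd)
  refine h1.congr fun z hz => ?_
  have hx : z.1.1 ∈ t.1.1 := hz.1.1.2
  change (P.assocProj (P.cls (s.1.2 z.1.1) z.2 z.1.2),
    P.assocFiber t.1 (P.cls (s.1.2 z.1.1) z.2 z.1.2)) = _
  rw [hst _ hz.1.1.symm, cls_act, assocFiber_cls t.2 hx, assocProj_cls,
    P.section_atlas _ t.2 _ hx]

/-- The set `(P × G × S¹)/ΩG` becomes a framed bundle by gluing the trivialisations that come from
the atlas of `P`; their transition maps are smooth by the exponential law for the loop group. -/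
theorem exists_isCaloronTransform : ∃ (Q : FramedBundle k G M) (q : P.Assoc ≃ Q.total),
    IsCaloronTransform P Q q := by
  have hopen : ∀ s : P.atlas, IsOpen ((s.1.1 ×ˢ univ) ×ˢ univ : Set ((M × Circle) × G)) :=
    fun s => ((P.isOpen_atlas _ s.2).prod isOpen_univ).prod isOpen_univ
  obtain ⟨top, charted, man, hchart⟩ := exists_isManifold_of_transitions
    (I := totalModel k M.dim) P.assocChart
    (fun a => by
      obtain ⟨s, hs, ha⟩ := P.cover (P.assocProj a).1
      exact ⟨⟨s, hs⟩, ha⟩)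
    (fun s t => by
      rw [assocChart_transition_source]
      exact (((P.isOpen_atlas _ s.2).inter (P.isOpen_atlas _ t.2)).prod isOpen_univ).prod
        isOpen_univ)
    P.contMDiffOn_assocChart_transition
  have hsrc : ∀ s, IsOpen (P.assocChart s).source := fun s => (hchart s).1
  have hto : ∀ s, ContMDiffOn (totalModel k M.dim) (totalModel k M.dim) ∞ (P.assocChart s)
      (P.assocChart s).source := fun s => (hchart s).2.1
  have hinv : ∀ s : P.atlas, ContMDiffOn (totalModel k M.dim) (totalModel k M.dim) ∞
      (fun z : (M × Circle) × G => P.cls (s.1.2 z.1.1) z.2 z.1.2)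
      ((s.1.1 ×ˢ univ) ×ˢ univ) := fun s => (hchart s).2.2
  have hproj : ContMDiff (totalModel k M.dim) ((𝓡 M.dim).prod (𝓡 1)) ∞ P.assocProj := by
    intro a
    obtain ⟨s, hs, ha⟩ := P.cover (P.assocProj a).1
    exact contMDiffAt_fst.comp a ((hto ⟨s, hs⟩).contMDiffAt ((hsrc ⟨s, hs⟩).mem_nhds ha))
  have hfiber : ∀ s : P.atlas, ContMDiffOn (totalModel k M.dim) (𝓡 k) ∞ (P.assocFiber s.1)
      {a | (P.assocProj a).1 ∈ s.1.1} := fun s => contMDiff_snd.comp_contMDiffOn (hto s)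
  have hact : ContMDiff ((totalModel k M.dim).prod (𝓡 k)) (totalModel k M.dim) ∞
      (fun x : P.Assoc × G => P.assocAct x.1 x.2) := by
    rintro ⟨a, g⟩
    obtain ⟨s, hs, ha⟩ := P.cover (P.assocProj a).1
    have h1 : ContMDiffOn ((totalModel k M.dim).prod (𝓡 k)) (totalModel k M.dim) ∞
        (fun x : P.Assoc × G => (P.assocProj x.1, P.assocFiber s x.1 * x.2))
        ({a | (P.assocProj a).1 ∈ s.1} ×ˢ univ) :=
      (hproj.comp contMDiff_fst).contMDiffOn.prodMk
        (((hfiber ⟨s, hs⟩).comp contMDiffOn_fst fun x hx => hx.1).mul contMDiffOn_snd)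
    have h2 := (hinv ⟨s, hs⟩).comp h1 fun x hx => ⟨⟨hx.1, mem_univ _⟩, mem_univ _⟩
    refine (h2.congr fun x hx => ?_).contMDiffAt
      (((hsrc ⟨s, hs⟩).prod isOpen_univ).mem_nhds ⟨ha, mem_univ _⟩)
    conv_lhs => rw [cls_assocFiber hs hx.1]
    rfl
  choose s hs hxs using P.cover
  have hfib : ∀ m, P.proj ((s m).2 m) = m := fun m => P.section_atlas _ (hs m) m (hxs m)
  -- The class `[p, 1, 1]` depends on `π p` only, since based loops have the value `1` at `1`.
  have hframe : ∀ p q : P.total, P.proj p = P.proj q → P.cls p 1 1 = P.cls q 1 1 := by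
    intro p q h
    obtain ⟨γ, rfl⟩ := P.transitive p q h
    rw [cls_act, γ.2.2, mul_one]
  refine ⟨
    { total := P.Assoc
      proj := P.assocProj
      act := P.assocAct
      act_one := fun a => by
        obtain ⟨p, g, θ, rfl⟩ := P.exists_cls a
        rw [assocAct_cls, mul_one]
      act_mul := fun a g h => by
        obtain ⟨p, g', θ, rfl⟩ := P.exists_cls a
        rw [assocAct_cls, assocAct_cls, assocAct_cls, mul_assoc]
      proj_act := P.assocProj_act
      smooth_proj := hproj
      smooth_act := hact
      locally_trivial := fun x => ?_
      frame := fun m => P.cls ((s m).2 m) 1 1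
      proj_frame := fun m => by rw [assocProj_cls, hfib]
      smooth_frame := fun m => ?_ }, Equiv.refl _, ⟨?_, ?_, ?_, ?_⟩⟩
  · refine ⟨(s x.1).1 ×ˢ univ, (P.isOpen_atlas _ (hs _)).prod isOpen_univ,
      ⟨hxs _, mem_univ _⟩, P.assocFiber (s x.1),
      fun y => P.cls ((s x.1).2 y.1) 1 y.2, ?_, ?_, ?_, ?_, ?_⟩
    · exact (hfiber ⟨_, hs x.1⟩).mono fun a ha => ha.1
    · exact (hinv ⟨_, hs x.1⟩).comp (contMDiff_id.prodMk contMDiff_const).contMDiffOn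
        fun y hy => ⟨⟨hy.1, mem_univ _⟩, mem_univ _⟩
    · intro y hy
      rw [assocProj_cls, P.section_atlas _ (hs _) _ hy.1]
    · intro a ha
      rw [assocAct_cls, one_mul]
      exact (cls_assocFiber (hs _) ha.1).symm
    · intro y hy g
      rw [assocAct_cls, one_mul, assocFiber_cls (hs _) hy.1]
  · have h1 : ContMDiffOn (𝓡 M.dim) (totalModel k M.dim) ∞
        (fun m' => P.cls ((s m).2 m') 1 1) (s m).1 :=
      (hinv ⟨_, hs m⟩).comp ((contMDiff_id.prodMk contMDiff_const).prodMk
        contMDiff_const).contMDiffOn fun y hy => ⟨⟨hy, mem_univ _⟩, mem_univ _⟩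
    refine (h1.congr fun m' hm' => hframe _ _ ?_).contMDiffAt
      ((P.isOpen_atlas _ (hs m)).mem_nhds (hxs m))
    rw [hfib, P.section_atlas _ (hs m) m' hm']
  · exact fun p g θ => rfl
  · exact fun p g θ h => rfl
  · exact fun p => hframe _ _ (hfib _)
  · rintro N c V hV hc ⟨y, g, θ⟩ ⟨hy : y ∈ V, -⟩
    rw [smoothOn_iff hV] at hc
    obtain ⟨h, hh, hch⟩ := hc.2 _ (hs (P.proj (c y)))
    have hW : IsOpen (V ∩ (fun y => P.proj (c y)) ⁻¹' (s (P.proj (c y))).1) :=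
      hc.1.continuousOn.isOpen_inter_preimage hV (P.isOpen_atlas _ (hs _))
    set W := V ∩ (fun y => P.proj (c y)) ⁻¹' (s (P.proj (c y))).1
    have h1 : ContMDiffOn ((𝓡 N.dim).prod ((𝓡 k).prod (𝓡 1))) (totalModel k M.dim) ∞
        (fun z : N × G × Circle => ((P.proj (c z.1), z.2.2), (h z.1).1 z.2.2 * z.2.1))
        (W ×ˢ univ) := by
      have a1 : ContMDiff ((𝓡 N.dim).prod ((𝓡 k).prod (𝓡 1))) (𝓡 1) ∞
          (fun z : N × G × Circle => z.2.2) := contMDiff_snd.comp contMDiff_snd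
      have a2 : ContMDiff ((𝓡 N.dim).prod ((𝓡 k).prod (𝓡 1))) (𝓡 k) ∞
          (fun z : N × G × Circle => z.2.1) := contMDiff_fst.comp contMDiff_snd
      exact ((hc.1.comp contMDiffOn_fst fun z hz => hz.1.1).prodMk a1.contMDiffOn).prodMk
        ((hh.comp (contMDiff_fst.prodMk a1).contMDiffOn
          fun z hz => ⟨hz.1, mem_univ _⟩).mul a2.contMDiffOn)
    have h2 := (hinv ⟨_, hs (P.proj (c y))⟩).comp h1
      fun z hz => ⟨⟨hz.1.2, mem_univ _⟩, mem_univ _⟩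
    refine ((h2.congr fun z hz => ?_).contMDiffAt
      ((hW.prod isOpen_univ).mem_nhds ⟨⟨hy, hxs _⟩, mem_univ _⟩)).contMDiffWithinAt
    change P.cls (c z.1) z.2.1 z.2.2 = _
    conv_lhs => rw [hch z.1 hz.1, cls_act]
    rfl

end LoopBundle

/-- In a caloron transform, a local section of `P` gives the local section
`(x, θ) ↦ [σ(x), 1, θ]`. -/
theorem IsCaloronTransform.smooth_section {M : Man.{u}} {P : LoopBundle k G M}
    {Q : FramedBundle k G M} {q : P.Assoc ≃ Q.total} (hQ : IsCaloronTransform P Q q)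
    {N : Man.{u}} {c : N → P.total} {V : Set N} (hV : IsOpen V) (hc : P.SmoothOn c V) :
    ContMDiffOn ((𝓡 N.dim).prod (𝓡 1)) (totalModel k M.dim) ∞
      (fun z : N × Circle => q (P.cls (c z.1) 1 z.2)) (V ×ˢ univ) :=
  (hQ.smooth N c V hV hc).comp
    (contMDiff_fst.prodMk (contMDiff_const.prodMk contMDiff_snd)).contMDiffOn
    fun _ hz => ⟨hz.1, mem_univ _⟩

/-- An equivariant map out of a caloron transform is smooth if it is smooth along the sections
`(x, θ) ↦ [σ(x), 1, θ]`. -/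
theorem IsCaloronTransform.contMDiff {M M' : Man.{u}} {P : LoopBundle k G M}
    {Q : FramedBundle k G M} {q : P.Assoc ≃ Q.total} (hQ : IsCaloronTransform P Q q)
    {Q' : FramedBundle k G M'} {F : Q.total → Q'.total}
    (hF : ∀ p g, F (Q.act p g) = Q'.act (F p) g)
    (hsec : ∀ s ∈ P.atlas, ContMDiffOn ((𝓡 M.dim).prod (𝓡 1)) (totalModel k M'.dim) ∞
      (fun z : M × Circle => F (q (P.cls (s.2 z.1) 1 z.2))) (s.1 ×ˢ univ)) :
    ContMDiff (totalModel k M.dim) (totalModel k M'.dim) ∞ F := by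
  refine FramedBundle.contMDiff_of_sections hF fun y => ?_
  obtain ⟨s, hs, hy⟩ := P.cover y.1
  refine ⟨s.1 ×ˢ univ, fun z => q (P.cls (s.2 z.1) 1 z.2),
    (P.isOpen_atlas s hs).prod isOpen_univ, ⟨hy, mem_univ _⟩, fun z hz => ?_,
    hQ.smooth_section (P.isOpen_atlas s hs) (LoopBundle.smoothOn_section hs), hsec s hs⟩
  rw [hQ.proj, P.section_atlas s hs _ hz.1]

theorem nonempty_caloronTransform : Nonempty (CaloronTransform k G) := by
  choose obj quot h using fun (M : Man.{u}) (P : LoopBundle k G M) => P.exists_isCaloronTransform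
  let F : ∀ {X Y : Bun k G} (_ : X ⟶ Y), (obj _ X.bundle).total → (obj _ Y.bundle).total :=
    fun {X Y} φ a => Quotient.lift (s := X.bundle.orbitSetoid)
      (fun a => quot _ Y.bundle (Y.bundle.cls (φ.total a.1) a.2.1 a.2.2)) (by
        rintro ⟨p, g, θ⟩ _ ⟨γ, rfl⟩
        change quot _ Y.bundle (Y.bundle.cls (φ.total p) g θ) =
          quot _ Y.bundle (Y.bundle.cls (φ.total (X.bundle.act p γ)) ((γ.1 θ)⁻¹ * g) θ)
        rw [φ.total_act, LoopBundle.cls_act, mul_inv_cancel_left]) ((quot _ X.bundle).symm a)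
  have hF : ∀ {X Y : Bun k G} (φ : X ⟶ Y) (p : X.bundle.total) (g : G) (θ : Circle),
      F φ (quot _ X.bundle (X.bundle.cls p g θ)) =
        quot _ Y.bundle (Y.bundle.cls (φ.total p) g θ) := by
    intro X Y φ p g θ
    simp only [F, Equiv.symm_apply_apply]
    rfl
  have hrep : ∀ {M : Man.{u}} (P : LoopBundle k G M) (a : (obj M P).total),
      ∃ p g θ, a = quot M P (P.cls p g θ) := by
    intro M P a
    obtain ⟨b, rfl⟩ := (quot M P).surjective a
    obtain ⟨p, g, θ, rfl⟩ := P.exists_cls b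
    exact ⟨p, g, θ, rfl⟩
  have hact : ∀ {X Y : Bun k G} (φ : X ⟶ Y) (a : (obj _ X.bundle).total) (g : G),
      F φ ((obj _ X.bundle).act a g) = (obj _ Y.bundle).act (F φ a) g := by
    intro X Y φ a g
    obtain ⟨p, g', θ, rfl⟩ := hrep X.bundle a
    rw [(h _ X.bundle).act, hF, hF, (h _ Y.bundle).act]
  refine ⟨{
    obj := fun {M} P => obj M P
    quot := fun {M} P => quot M P
    isCaloronTransform := fun {M} P => h M P
    map := fun {X Y} φ =>
      { base := φ.base
        total := F φ
        proj_total := fun a => ?_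
        total_act := hact φ
        total_frame := fun m => ?_
        smooth := ?_ }
    map_base := fun φ => rfl
    map_total := hF }⟩
  · obtain ⟨p, g, θ, rfl⟩ := hrep X.bundle a
    change (obj _ Y.bundle).proj (F φ (quot _ X.bundle (X.bundle.cls p g θ))) =
      (Man.fn φ.base ((obj _ X.bundle).proj (quot _ X.bundle (X.bundle.cls p g θ))).1,
        ((obj _ X.bundle).proj (quot _ X.bundle (X.bundle.cls p g θ))).2)
    rw [hF, (h _ X.bundle).proj, (h _ Y.bundle).proj, φ.proj_total]
  · change F φ ((obj _ X.bundle).frame m) = (obj _ Y.bundle).frame (Man.fn φ.base m)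
    obtain ⟨s, hs, hm⟩ := X.bundle.cover m
    have h1 := X.bundle.section_atlas s hs m hm
    have h2 := φ.proj_total (s.2 m)
    rw [h1] at h2
    rw [← h2, (h _ Y.bundle).frame, ← hF, ← (h _ X.bundle).frame, h1]
  · refine (h _ X.bundle).contMDiff (Q' := obj _ Y.bundle) (hact φ) fun s hs => ?_
    refine ((h _ Y.bundle).smooth_section (X.bundle.isOpen_atlas s hs)
      (φ.smooth _ _ _ (X.bundle.isOpen_atlas s hs) (LoopBundle.smoothOn_section hs))).congr
      fun z _ => ?_
    exact hF φ _ _ _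

/-! ### Local sections over `U × S¹` that extend the framing -/

/-- A smooth function that is the identity up to a point of the interval `(c, b)` and maps the
whole half-line `(c, ∞)` into that interval. -/
theorem exists_smooth_clamp {c b : ℝ} (h : c < b) : ∃ (ρ : ℝ → ℝ) (e : ℝ), c < e ∧ e < b ∧
    ContDiff ℝ ∞ ρ ∧ (∀ t ≤ e, ρ t = t) ∧ ∀ t, c < t → ρ t ∈ Ioo c b := by
  obtain ⟨e, hce, heb⟩ := exists_between h
  obtain ⟨f, hef, hfb⟩ := exists_between heb
  let χ : ℝ → ℝ := fun t => Real.smoothTransition ((t - e) / (f - e))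
  have hfe : 0 < f - e := sub_pos.2 hef
  have hχ : ContDiff ℝ ∞ χ := Real.smoothTransition.contDiff.comp (by fun_prop)
  have h0 : ∀ t ≤ e, χ t = 0 := fun t ht =>
    Real.smoothTransition.zero_of_nonpos (div_nonpos_of_nonpos_of_nonneg (by linarith) hfe.le)
  have h1 : ∀ t, f ≤ t → χ t = 1 := fun t ht =>
    Real.smoothTransition.one_of_one_le ((one_le_div hfe).2 (by linarith))
  refine ⟨fun t => t + χ t * (e - t), e, hce, heb, by fun_prop, fun t ht => by simp [h0 t ht],
    fun t ht => ?_⟩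
  have hn : 0 ≤ χ t := Real.smoothTransition.nonneg _
  have hl : χ t ≤ 1 := Real.smoothTransition.le_one _
  rcases le_or_gt t e with hte | hte
  · simp only [h0 t hte, zero_mul, add_zero]
    exact ⟨ht, by linarith⟩
  · rcases le_or_gt f t with hft | hft
    · simp only [h1 t hft, one_mul, add_sub_cancel]
      exact ⟨hce, heb⟩
    · constructor <;> nlinarith

variable (k) in
/-- Near `g₀` the points `g` of `G` are joined to `1` by paths `τ ↦ Λ(τ, g)` that depend smoothly
on both variables, and that are constant for `τ ≤ 0` and for `τ ≥ 1`. -/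
def HasSmoothContraction (g₀ : G) : Prop :=
  ∃ (N : Set G) (Λ : ℝ × G → G), IsOpen N ∧ g₀ ∈ N ∧
    ContMDiffOn (𝓘(ℝ, ℝ).prod (𝓡 k)) (𝓡 k) ∞ Λ (univ ×ˢ N) ∧
    (∀ g ∈ N, ∀ τ ≤ 0, Λ (τ, g) = 1) ∧ ∀ g ∈ N, ∀ τ, 1 ≤ τ → Λ (τ, g) = g

theorem hasSmoothContraction_one : HasSmoothContraction k (1 : G) := by
  let φ := chartAt (EuclideanSpace ℝ (Fin k)) (1 : G)
  have h1 : (1 : G) ∈ φ.source := mem_chart_source _ _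
  obtain ⟨r, hr, hball⟩ := Metric.isOpen_iff.1 φ.open_target _ (φ.map_source h1)
  have hφs : ContMDiffOn (𝓡 k) 𝓘(ℝ, EuclideanSpace ℝ (Fin k)) ∞ φ φ.source := contMDiffOn_chart
  have hφt : ContMDiffOn 𝓘(ℝ, EuclideanSpace ℝ (Fin k)) (𝓡 k) ∞ φ.symm φ.target :=
    contMDiffOn_chart_symm
  have hχ : ContMDiff 𝓘(ℝ, ℝ) 𝓘(ℝ, ℝ) ∞ Real.smoothTransition :=
    Real.smoothTransition.contDiff.contMDiff
  refine ⟨φ.source ∩ φ ⁻¹' Metric.ball (φ 1) r,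
    fun z => φ.symm (φ 1 + Real.smoothTransition z.1 • (φ z.2 - φ 1)),
    φ.isOpen_inter_preimage Metric.isOpen_ball, ⟨h1, Metric.mem_ball_self hr⟩, ?_, ?_, ?_⟩
  · refine hφt.comp (contMDiffOn_const.add ((hχ.comp contMDiff_fst).contMDiffOn.smul
      ((hφs.comp contMDiffOn_snd fun z hz => hz.2.1).sub contMDiffOn_const))) fun z hz => hball ?_
    rw [Metric.mem_ball, dist_eq_norm, add_sub_cancel_left, norm_smul, Real.norm_eq_abs,
      abs_of_nonneg (Real.smoothTransition.nonneg _)]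
    have h2 : ‖φ z.2 - φ 1‖ < r := by simpa [dist_eq_norm] using hz.2.2
    exact lt_of_le_of_lt (mul_le_of_le_one_left (norm_nonneg _)
      (Real.smoothTransition.le_one _)) h2
  · intro g _ τ hτ
    simp only [Real.smoothTransition.zero_of_nonpos hτ, zero_smul, add_zero]
    exact φ.left_inv h1
  · intro g hg τ hτ
    simp only [Real.smoothTransition.one_of_one_le hτ, one_smul, add_sub_cancel]
    exact φ.left_inv hg.1

theorem HasSmoothContraction.mul {g₀ h₀ : G} (hg : HasSmoothContraction k g₀)
    (hh : HasSmoothContraction k h₀) : HasSmoothContraction k (g₀ * h₀) := by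
  have : IsTopologicalGroup G := topologicalGroup_of_lieGroup (𝓡 k) ∞
  obtain ⟨N, Λ, -, hgN, hΛ, hΛ0, hΛ1⟩ := hg
  obtain ⟨N', Λ', hN', hhN', hΛ', hΛ0', hΛ1'⟩ := hh
  refine ⟨(fun g => g₀⁻¹ * g) ⁻¹' N', fun z => Λ (z.1, g₀) * Λ' (z.1, g₀⁻¹ * z.2),
    hN'.preimage (continuous_const_mul _), by simpa using hhN', ?_, ?_, ?_⟩
  · refine (hΛ.comp (contMDiff_fst.prodMk contMDiff_const).contMDiffOn
      fun z _ => ⟨mem_univ _, hgN⟩).mul (hΛ'.comp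
      (contMDiff_fst.prodMk (contMDiff_const.mul contMDiff_snd)).contMDiffOn
      fun z hz => ⟨mem_univ _, hz.2⟩)
  · intro g hg τ hτ
    simp only [hΛ0 _ hgN τ hτ, hΛ0' _ hg τ hτ, mul_one]
  · intro g hg τ hτ
    simp only [hΛ1 _ hgN τ hτ, hΛ1' _ hg τ hτ, mul_inv_cancel_left]

theorem HasSmoothContraction.inv {g₀ : G} (hg : HasSmoothContraction k g₀) :
    HasSmoothContraction k g₀⁻¹ := by
  have : IsTopologicalGroup G := topologicalGroup_of_lieGroup (𝓡 k) ∞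
  obtain ⟨N, Λ, hN, hgN, hΛ, hΛ0, hΛ1⟩ := hg
  refine ⟨N⁻¹, fun z => (Λ (z.1, z.2⁻¹))⁻¹, hN.inv, by simpa using hgN, ?_, ?_, ?_⟩
  · exact (hΛ.comp (contMDiff_fst.prodMk contMDiff_snd.inv).contMDiffOn
      fun z hz => ⟨mem_univ _, hz.2⟩).inv
  · intro g hg τ hτ
    simp only [hΛ0 _ hg τ hτ, inv_one]
  · intro g hg τ hτ
    simp only [hΛ1 _ hg τ hτ, inv_inv]

/-- The elements with a smooth contraction form an open subgroup, which is all of a connected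
group. -/
theorem hasSmoothContraction [ConnectedSpace G] (g : G) : HasSmoothContraction k g := by
  have : IsTopologicalGroup G := topologicalGroup_of_lieGroup (𝓡 k) ∞
  let S : Subgroup G :=
    { carrier := {g | HasSmoothContraction k g}
      mul_mem' := HasSmoothContraction.mul
      one_mem' := hasSmoothContraction_one
      inv_mem' := HasSmoothContraction.inv }
  have hS : IsOpen (S : Set G) := by
    rw [isOpen_iff_mem_nhds]
    rintro g ⟨N, Λ, hN, hgN, h⟩
    exact mem_of_superset (hN.mem_nhds hgN) fun g' hg' => ⟨N, Λ, hN, hg', h⟩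
  have hclopen : IsClopen (S : Set G) := ⟨S.isClosed_of_isOpen hS, hS⟩
  have huniv := hclopen.eq_univ ⟨1, S.one_mem⟩
  change g ∈ (S : Set G)
  rw [huniv]
  exact mem_univ g

namespace FramedBundle

variable {M : Man.{u}} (Q : FramedBundle k G M)

/-- There is a smooth section of the bundle over `U × (a, b)`, where `U` is a neighbourhood of `m₀`
and the interval `(a, b)` parametrises an arc of the circle, possibly with overlaps. -/
def HasArcSection (m₀ : M) (a b : ℝ) : Prop :=
  ∃ (U : Set M) (s : M × ℝ → Q.total), IsOpen U ∧ m₀ ∈ U ∧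
    ContMDiffOn ((𝓡 M.dim).prod 𝓘(ℝ, ℝ)) (totalModel k M.dim) ∞ s (U ×ˢ Ioo a b) ∧
    ∀ p ∈ U ×ˢ Ioo a b, Q.proj (s p) = (p.1, Circle.exp p.2)

variable {Q} {m₀ : M}

theorem HasArcSection.mono {a b a' b' : ℝ} (h : Q.HasArcSection m₀ a b) (ha : a ≤ a')
    (hb : b' ≤ b) : Q.HasArcSection m₀ a' b' := by
  obtain ⟨U, s, hU, hm, hs, hps⟩ := h
  have hsub : U ×ˢ Ioo a' b' ⊆ U ×ˢ Ioo a b := prod_mono_right (Ioo_subset_Ioo ha hb)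
  exact ⟨U, s, hU, hm, hs.mono hsub, fun p hp => hps p (hsub hp)⟩

variable (Q m₀) in
theorem exists_hasArcSection (t : ℝ) : ∃ ε > 0, Q.HasArcSection m₀ (t - ε) (t + ε) := by
  obtain ⟨W, hW, hmW, -, σ, -, hσ, hpσ, -⟩ := Q.locally_trivial (m₀, Circle.exp t)
  have hcont : Continuous fun p : M × ℝ => (p.1, Circle.exp p.2) := by fun_prop
  obtain ⟨U, hU, T, hT, hUT⟩ := mem_nhds_prod_iff.1 ((hW.preimage hcont).mem_nhds
    (show (m₀, t) ∈ (fun p : M × ℝ => (p.1, Circle.exp p.2)) ⁻¹' W from hmW))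
  obtain ⟨U', hU'U, hU', hmU'⟩ := mem_nhds_iff.1 hU
  obtain ⟨ε, hε, hεT⟩ := Metric.mem_nhds_iff.1 hT
  rw [Real.ball_eq_Ioo] at hεT
  have hmaps : ∀ p ∈ U' ×ˢ Ioo (t - ε) (t + ε), (p.1, Circle.exp p.2) ∈ W :=
    fun p hp => hUT ⟨hU'U hp.1, hεT hp.2⟩
  exact ⟨ε, hε, U', fun p => σ (p.1, Circle.exp p.2), hU', hmU',
    hσ.comp (contMDiff_fst.prodMk (contMDiff_circleExp.comp contMDiff_snd)).contMDiffOn hmaps,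
    fun p hp => hpσ _ (hmaps p hp)⟩

/-- Sections over overlapping arcs can be glued: on the overlap they differ by a smooth map into
`G`, and this map extends over the second arc after a reparametrisation of that arc. -/
theorem HasArcSection.glue {a b c d : ℝ} (h₁ : Q.HasArcSection m₀ a b)
    (h₂ : Q.HasArcSection m₀ c d) (hac : a ≤ c) (hcb : c < b) (hbd : b ≤ d) :
    Q.HasArcSection m₀ a d := by
  obtain ⟨U₁, s₁, hU₁, hm₁, hs₁, hp₁⟩ := h₁
  obtain ⟨U₂, s₂, hU₂, hm₂, hs₂, hp₂⟩ := h₂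
  obtain ⟨ρ, e, hce, heb, hρ, hρe, hρc⟩ := exists_smooth_clamp hcb
  set U := U₁ ∩ U₂ with hUdef
  have hU : IsOpen U := hU₁.inter hU₂
  have hs₁' : U ×ˢ Ioo c b ⊆ U₁ ×ˢ Ioo a b :=
    prod_mono inter_subset_left (Ioo_subset_Ioo_left hac)
  have hs₂' : U ×ˢ Ioo c b ⊆ U₂ ×ˢ Ioo c d :=
    prod_mono inter_subset_right (Ioo_subset_Ioo_right hbd)
  have hex : ∀ p, ∃ g, p ∈ U ×ˢ Ioo c b → s₁ p = Q.act (s₂ p) g := by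
    intro p
    by_cases hp : p ∈ U ×ˢ Ioo c b
    · obtain ⟨g, hg⟩ := Q.transitive (p := s₂ p) (q := s₁ p) (by
        rw [hp₁ p (hs₁' hp), hp₂ p (hs₂' hp)])
      exact ⟨g, fun _ => hg⟩
    · exact ⟨1, fun h => absurd h hp⟩
  choose g hg using hex
  have hgs : ContMDiffOn ((𝓡 M.dim).prod 𝓘(ℝ, ℝ)) (𝓡 k) ∞ g (U ×ˢ Ioo c b) :=
    contMDiffOn_div (hs₂.mono hs₂') (hs₁.mono hs₁') hg
  let s : M × ℝ → Q.total := fun p =>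
    if p.2 < e then s₁ p else Q.act (s₂ p) (g (p.1, ρ p.2))
  have hleft : ∀ p : M × ℝ, p.2 < e → s p = s₁ p := fun p hp => if_pos hp
  have hright : ∀ p ∈ U ×ˢ Ioo c d, s p = Q.act (s₂ p) (g (p.1, ρ p.2)) := by
    intro p hp
    rcases lt_or_ge p.2 e with h | h
    · rw [hleft p h, hρe _ h.le]
      exact hg p ⟨hp.1, hp.2.1, h.trans heb⟩
    · exact if_neg h.not_gt
  refine ⟨U, s, hU, ⟨hm₁, hm₂⟩, ?_, ?_⟩
  · intro p hp
    rcases lt_or_ge p.2 e with h | h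
    · have hmem : U₁ ×ˢ Ioo a e ∈ 𝓝 p := (hU₁.prod isOpen_Ioo).mem_nhds ⟨hp.1.1, hp.2.1, h⟩
      refine (((hs₁.mono (prod_mono_right (Ioo_subset_Ioo_right heb.le))).congr
        fun q hq => ?_).contMDiffAt hmem).contMDiffWithinAt
      exact hleft q hq.2.2
    · have hmem : U ×ˢ Ioo c d ∈ 𝓝 p :=
        (hU.prod isOpen_Ioo).mem_nhds ⟨hp.1, hce.trans_le h, hp.2.2⟩
      have h1 : ContMDiffOn ((𝓡 M.dim).prod 𝓘(ℝ, ℝ)) (𝓡 k) ∞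
          (fun p : M × ℝ => g (p.1, ρ p.2)) (U ×ˢ Ioo c d) :=
        hgs.comp (contMDiff_fst.prodMk (hρ.contMDiff.comp contMDiff_snd)).contMDiffOn
          fun q hq => ⟨hq.1, hρc _ hq.2.1⟩
      exact (((contMDiffOn_act (hs₂.mono (prod_mono_left inter_subset_right)) h1).congr
        hright).contMDiffAt hmem).contMDiffWithinAt
  · intro p hp
    rcases lt_or_ge p.2 e with h | h
    · rw [hleft p h]
      exact hp₁ p ⟨hp.1.1, hp.2.1, h.trans heb⟩
    · have hcd : p.2 ∈ Ioo c d := ⟨hce.trans_le h, hp.2.2⟩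
      rw [hright p ⟨hp.1, hcd⟩, Q.proj_act]
      exact hp₂ p ⟨hp.1.2, hcd⟩

variable (Q m₀) in
theorem hasArcSection (a b : ℝ) : Q.HasArcSection m₀ a b := by
  by_contra hb
  have hab : a ≤ b := by
    by_contra hab
    exact hb ⟨univ, fun _ => Q.frame m₀, isOpen_univ, mem_univ _,
      by simp [Ioo_eq_empty (fun h => hab h.le)], by simp [Ioo_eq_empty (fun h => hab h.le)]⟩
  -- The supremum of the endpoints reached by sections cannot be smaller than `b`.
  let S : Set ℝ := {x | x ≤ b ∧ Q.HasArcSection m₀ a x}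
  have haS : a ∈ S := ⟨hab, univ, fun _ => Q.frame m₀, isOpen_univ, mem_univ _, by simp, by simp⟩
  have hbdd : BddAbove S := ⟨b, fun x hx => hx.1⟩
  obtain ⟨ε, hε, hsec⟩ := exists_hasArcSection Q m₀ (sSup S)
  have hreach : Q.HasArcSection m₀ a (sSup S + ε) := by
    obtain ⟨x, hx, hlt⟩ := exists_lt_of_lt_csSup ⟨a, haS⟩ (sub_lt_self (sSup S) hε)
    rcases le_total (sSup S - ε) a with h | h
    · exact hsec.mono h le_rfl
    · exact hx.2.glue hsec h hlt (by linarith [le_csSup hbdd hx])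
  rcases le_total b (sSup S + ε) with h | h
  · exact hb (hreach.mono le_rfl h)
  · linarith [le_csSup hbdd (show sSup S + ε ∈ S from ⟨h, hreach⟩)]

/-- A section over an arc can be normalised so as to extend the framing. -/
theorem exists_framed_arcSection (m₀ : M) {a b : ℝ} (ha : a < 0) (hb : 0 < b) :
    ∃ (U : Set M) (s : M × ℝ → Q.total), IsOpen U ∧ m₀ ∈ U ∧
      ContMDiffOn ((𝓡 M.dim).prod 𝓘(ℝ, ℝ)) (totalModel k M.dim) ∞ s (U ×ˢ Ioo a b) ∧
      (∀ p ∈ U ×ˢ Ioo a b, Q.proj (s p) = (p.1, Circle.exp p.2)) ∧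
      ∀ x ∈ U, s (x, 0) = Q.frame x := by
  obtain ⟨U, s, hU, hm, hs, hps⟩ := hasArcSection Q m₀ a b
  have hex : ∀ x, ∃ g, x ∈ U → Q.frame x = Q.act (s (x, 0)) g := by
    intro x
    by_cases hx : x ∈ U
    · obtain ⟨g, hg⟩ := Q.transitive (p := s (x, 0)) (q := Q.frame x) (by
        rw [hps _ ⟨hx, ha, hb⟩, Q.proj_frame, Circle.exp_zero])
      exact ⟨g, fun _ => hg⟩
    · exact ⟨1, fun h => absurd h hx⟩
  choose g hg using hex
  have hgs : ContMDiffOn (𝓡 M.dim) (𝓡 k) ∞ g U :=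
    contMDiffOn_div (hs.comp (contMDiff_id.prodMk contMDiff_const).contMDiffOn
      fun x hx => ⟨hx, ha, hb⟩) Q.smooth_frame.contMDiffOn hg
  refine ⟨U, fun p => Q.act (s p) (g p.1), hU, hm, contMDiffOn_act hs (hgs.comp contMDiffOn_fst
    fun p hp => hp.1), fun p hp => by rw [Q.proj_act, hps p hp], fun x hx => (hg x hx).symm⟩

/-- A smooth map on an arc of length slightly more than `2π` that takes equal values on the two
overlapping ends descends to the circle. -/
theorem contMDiffOn_circle_descent {U : Set M} {s : M × ℝ → Q.total} {δ : ℝ} (hδ : 0 < δ)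
    (hδ1 : δ ≤ 1)
    (hs : ContMDiffOn ((𝓡 M.dim).prod 𝓘(ℝ, ℝ)) (totalModel k M.dim) ∞ s
      (U ×ˢ Ioo (-Real.pi - δ) (Real.pi + δ)))
    (hper : ∀ x ∈ U, ∀ t ∈ Ioo (-Real.pi - δ) (-Real.pi + δ), s (x, t + 2 * Real.pi) = s (x, t)) :
    ContMDiffOn ((𝓡 M.dim).prod (𝓡 1)) (totalModel k M.dim) ∞
      (fun z : M × Circle => s (z.1, Complex.arg z.2)) (U ×ˢ univ) := by
  have hpi := Real.pi_gt_three
  have harg : ∀ z : Circle, Complex.arg z ∈ Ioo (-Real.pi - δ) (Real.pi + δ) := fun z =>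
    ⟨by linarith [Complex.neg_pi_lt_arg (z : ℂ)], by linarith [Complex.arg_le_pi (z : ℂ)]⟩
  have hplus : ∀ x ∈ U, ∀ t t', t ∈ Ioo (-Real.pi - δ) (Real.pi + δ) →
      t' ∈ Ioo (-Real.pi - δ) (Real.pi + δ) → ∀ m : ℕ, t = t' + m * (2 * Real.pi) →
      s (x, t) = s (x, t') := by
    intro x hx t t' ht ht' m hm
    match m with
    | 0 => simp_all
    | 1 =>
      rw [hm, Nat.cast_one, one_mul]
      exact hper x hx t' ⟨ht'.1, by push_cast at hm; linarith [ht.2]⟩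
    | m + 2 =>
      exfalso
      have h1 : (0 : ℝ) ≤ m := m.cast_nonneg
      push_cast at hm
      nlinarith [ht.2, ht'.1]
  have hsame : ∀ x ∈ U, ∀ t t', t ∈ Ioo (-Real.pi - δ) (Real.pi + δ) →
      t' ∈ Ioo (-Real.pi - δ) (Real.pi + δ) → Circle.exp t = Circle.exp t' →
      s (x, t) = s (x, t') := by
    intro x hx t t' ht ht' h
    obtain ⟨m, hm⟩ := Circle.exp_eq_exp.1 h
    obtain ⟨j, rfl | rfl⟩ := m.eq_nat_or_neg
    · exact hplus x hx t t' ht ht' j (by simpa using hm)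
    · refine (hplus x hx t' t ht' ht j ?_).symm
      push_cast at hm
      linarith
  rintro ⟨x, z⟩ ⟨hx : x ∈ U, -⟩
  obtain ⟨a, ha, has⟩ := exists_smooth_angle z
  -- Shift the smooth angle by a multiple of `2π` so that its value at `z` is the argument.
  let a' : Circle → ℝ := fun w => a w + (Complex.arg z - a z)
  have ha' : ∀ w, Circle.exp (a' w) = w := fun w => by
    simp only [a', Circle.exp_add, Circle.exp_sub, ha, Circle.exp_arg, div_self', mul_one]
  have haz : a' z = Complex.arg z := by simp [a']
  have has' : ContMDiffAt (𝓡 1) 𝓘(ℝ, ℝ) ∞ a' z := has.add contMDiffAt_const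
  have hsnd : ContMDiffAt ((𝓡 M.dim).prod (𝓡 1)) 𝓘(ℝ, ℝ) ∞
      (fun q : M × Circle => a' q.2) (x, z) :=
    ContMDiffAt.comp (x, z) (g := a') has' contMDiffAt_snd
  have h1 : ContMDiffWithinAt ((𝓡 M.dim).prod (𝓡 1)) (totalModel k M.dim) ∞
      (fun q : M × Circle => s (q.1, a' q.2)) (U ×ˢ univ ∩
        (fun q : M × Circle => a' q.2) ⁻¹' Ioo (-Real.pi - δ) (Real.pi + δ)) (x, z) := by
    refine (hs (x, a' z) ⟨hx, by rw [haz]; exact harg z⟩).comp (x, z)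
      (f := fun q : M × Circle => (q.1, a' q.2)) ?_ fun q hq => ⟨hq.1.1, hq.2⟩
    exact (contMDiffAt_fst.prodMk hsnd).contMDiffWithinAt
  have hnear : ∀ᶠ q : M × Circle in 𝓝 (x, z), a' q.2 ∈ Ioo (-Real.pi - δ) (Real.pi + δ) :=
    hsnd.continuousAt.eventually
      (isOpen_Ioo.mem_nhds (by change a' z ∈ _; rw [haz]; exact harg z))
  have h2 := h1.mono_of_mem_nhdsWithin (t := U ×ˢ univ)
    (inter_mem self_mem_nhdsWithin (mem_nhdsWithin_of_mem_nhds hnear))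
  refine h2.congr_of_eventuallyEq ?_ (by simp only [haz])
  filter_upwards [self_mem_nhdsWithin, mem_nhdsWithin_of_mem_nhds hnear] with q hq hq'
  exact hsame q.1 hq.1 _ _ (harg _) hq' (by rw [ha', Circle.exp_arg])

/-- Since `G` is connected, the framing extends locally to a smooth section over `U × S¹`: the
monodromy of a section over a long arc is deformed to the identity near the end of the arc. -/
theorem exists_section_extending_frame [ConnectedSpace G] (m₀ : M) :
    ∃ (U : Set M) (σ : M × Circle → Q.total), IsOpen U ∧ m₀ ∈ U ∧
      ContMDiffOn ((𝓡 M.dim).prod (𝓡 1)) (totalModel k M.dim) ∞ σ (U ×ˢ univ) ∧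
      (∀ z ∈ U ×ˢ (univ : Set Circle), Q.proj (σ z) = z) ∧ ∀ x ∈ U, σ (x, 1) = Q.frame x := by
  have hpi := Real.pi_gt_three
  obtain ⟨U, s, hU, hm, hs, hps, hs0⟩ := Q.exists_framed_arcSection m₀
    (a := -Real.pi - 1) (b := Real.pi + 1) (by linarith) (by linarith)
  have hI : ∀ t ∈ Ioo (-Real.pi - 1) (-Real.pi + 1), t ∈ Ioo (-Real.pi - 1) (Real.pi + 1) ∧
      t + 2 * Real.pi ∈ Ioo (-Real.pi - 1) (Real.pi + 1) := fun t ht =>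
    ⟨⟨ht.1, by linarith [ht.2]⟩, by linarith [ht.1], by linarith [ht.2]⟩
  have hex : ∀ p : M × ℝ, ∃ g, p ∈ U ×ˢ Ioo (-Real.pi - 1) (-Real.pi + 1) →
      s (p.1, p.2 + 2 * Real.pi) = Q.act (s p) g := by
    intro p
    by_cases hp : p ∈ U ×ˢ Ioo (-Real.pi - 1) (-Real.pi + 1)
    · obtain ⟨g, hg⟩ := Q.transitive (p := s p) (q := s (p.1, p.2 + 2 * Real.pi)) (by
        rw [hps p ⟨hp.1, (hI _ hp.2).1⟩, hps (p.1, p.2 + 2 * Real.pi) ⟨hp.1, (hI _ hp.2).2⟩,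
          Circle.exp_add_two_pi])
      exact ⟨g, fun _ => hg⟩
    · exact ⟨1, fun h => absurd h hp⟩
  -- The monodromy `c` compares the two ends of the arc.
  choose c hc using hex
  have hcs : ContMDiffOn ((𝓡 M.dim).prod 𝓘(ℝ, ℝ)) (𝓡 k) ∞ c
      (U ×ˢ Ioo (-Real.pi - 1) (-Real.pi + 1)) := by
    refine contMDiffOn_div (hs.mono fun p hp => ⟨hp.1, (hI _ hp.2).1⟩)
      (hs.comp (contMDiff_fst.prodMk (contMDiff_snd.add contMDiff_const)).contMDiffOn
        fun p hp => ⟨hp.1, (hI _ hp.2).2⟩) hc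
  obtain ⟨N, Λ, hN, hmN, hΛ, hΛ0, hΛ1⟩ := hasSmoothContraction (k := k) (c (m₀, -Real.pi))⁻¹
  have hnear : ∀ᶠ p : M × ℝ in 𝓝 (m₀, -Real.pi), (c p)⁻¹ ∈ N := by
    have h1 : ContinuousOn (fun p => (c p)⁻¹) (U ×ˢ Ioo (-Real.pi - 1) (-Real.pi + 1)) :=
      hcs.inv.continuousOn
    exact (h1.continuousAt ((hU.prod isOpen_Ioo).mem_nhds
      ⟨hm, by constructor <;> linarith⟩)).eventually (hN.mem_nhds hmN)
  obtain ⟨U₁, hU₁, T, hT, hUT⟩ := mem_nhds_prod_iff.1 hnear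
  obtain ⟨U₂, hU₂U, hU₂, hmU₂⟩ := mem_nhds_iff.1 hU₁
  obtain ⟨ε, hε, hεT⟩ := Metric.mem_nhds_iff.1 hT
  rw [Real.ball_eq_Ioo] at hεT
  -- On the ends of width `δ` the monodromy stays where the contraction of `G` is defined; `δ ≤ 1`
  -- keeps the two ends apart.
  let δ := min ε 1
  have hδ : 0 < δ := lt_min hε one_pos
  have hδ1 : δ ≤ 1 := min_le_right _ _
  have hδε : δ ≤ ε := min_le_left _ _
  set W := U ∩ U₂ with hW
  have hWo : IsOpen W := hU.inter hU₂
  have hcN : ∀ x ∈ W, ∀ t ∈ Ioo (-Real.pi - δ) (-Real.pi + δ), (c (x, t))⁻¹ ∈ N :=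
    fun x hx t ht => hUT ⟨hU₂U hx.2, hεT ⟨by linarith [ht.1], by linarith [ht.2]⟩⟩
  -- The function `χ` is nonpositive before `π - 3δ/4` and at least `1` after `π - δ/2`.
  let χ : ℝ → ℝ := fun t => (t - (Real.pi - 3 * δ / 4)) / (δ / 4)
  let s' : M × ℝ → Q.total := fun p =>
    if p.2 < Real.pi - 3 * δ / 4 then s p
    else Q.act (s p) (Λ (χ p.2, (c (p.1, p.2 - 2 * Real.pi))⁻¹))
  have hleft : ∀ p : M × ℝ, p.2 < Real.pi - 3 * δ / 4 → s' p = s p := fun p hp => if_pos hp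
  have hright : ∀ p ∈ W ×ˢ Ioo (Real.pi - δ) (Real.pi + δ),
      s' p = Q.act (s p) (Λ (χ p.2, (c (p.1, p.2 - 2 * Real.pi))⁻¹)) := by
    intro p hp
    rcases lt_or_ge p.2 (Real.pi - 3 * δ / 4) with h | h
    · rw [hleft p h, hΛ0 _ (hcN _ hp.1 _ ⟨by linarith [hp.2.1], by linarith [hp.2.2]⟩) _
        (div_nonpos_of_nonpos_of_nonneg (by linarith) (by linarith)), Q.act_one]
    · exact if_neg h.not_gt
  have hs' : ContMDiffOn ((𝓡 M.dim).prod 𝓘(ℝ, ℝ)) (totalModel k M.dim) ∞ s'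
      (W ×ˢ Ioo (-Real.pi - δ / 2) (Real.pi + δ / 2)) := by
    intro p hp
    rcases lt_or_ge p.2 (Real.pi - 3 * δ / 4) with h | h
    · have hmem : W ×ˢ Ioo (-Real.pi - 1) (Real.pi - 3 * δ / 4) ∈ 𝓝 p :=
        (hWo.prod isOpen_Ioo).mem_nhds ⟨hp.1, by linarith [hp.2.1], h⟩
      refine (((hs.mono ?_).congr fun q hq => hleft q hq.2.2).contMDiffAt hmem).contMDiffWithinAt
      exact prod_mono inter_subset_left (Ioo_subset_Ioo_right (by linarith))
    · have hmem : W ×ˢ Ioo (Real.pi - δ) (Real.pi + δ) ∈ 𝓝 p :=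
        (hWo.prod isOpen_Ioo).mem_nhds ⟨hp.1, by linarith, by linarith [hp.2.2]⟩
      have hχ : ContMDiff 𝓘(ℝ, ℝ) 𝓘(ℝ, ℝ) ∞ χ := by
        apply ContDiff.contMDiff
        fun_prop
      have h1 : ContMDiffOn ((𝓡 M.dim).prod 𝓘(ℝ, ℝ)) (𝓡 k) ∞
          (fun p : M × ℝ => (c (p.1, p.2 - 2 * Real.pi))⁻¹)
          (W ×ˢ Ioo (Real.pi - δ) (Real.pi + δ)) :=
        (hcs.comp (contMDiff_fst.prodMk (contMDiff_snd.sub contMDiff_const)).contMDiffOn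
          fun q hq => ⟨hq.1.1, by linarith [hq.2.1], by linarith [hq.2.2]⟩).inv
      have h2 : ContMDiffOn ((𝓡 M.dim).prod 𝓘(ℝ, ℝ)) (𝓡 k) ∞
          (fun p : M × ℝ => Λ (χ p.2, (c (p.1, p.2 - 2 * Real.pi))⁻¹))
          (W ×ˢ Ioo (Real.pi - δ) (Real.pi + δ)) :=
        hΛ.comp ((hχ.comp contMDiff_snd).contMDiffOn.prodMk h1) fun q hq =>
          ⟨mem_univ _, hcN _ hq.1 _ ⟨by linarith [hq.2.1], by linarith [hq.2.2]⟩⟩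
      refine (((contMDiffOn_act (hs.mono ?_) h2).congr hright).contMDiffAt hmem).contMDiffWithinAt
      exact prod_mono inter_subset_left (Ioo_subset_Ioo (by linarith) (by linarith))
  have hper : ∀ x ∈ W, ∀ t ∈ Ioo (-Real.pi - δ / 2) (-Real.pi + δ / 2),
      s' (x, t + 2 * Real.pi) = s' (x, t) := by
    intro x hx t ht
    have ht' : t ∈ Ioo (-Real.pi - δ) (-Real.pi + δ) :=
      ⟨by linarith [ht.1], by linarith [ht.2]⟩
    rw [hright (x, t + 2 * Real.pi) ⟨hx, by linarith [ht.1], by linarith [ht.2]⟩,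
      hleft (x, t) (by change t < _; linarith [ht.2])]
    simp only [add_sub_cancel_right]
    rw [hΛ1 _ (hcN x hx t ht') _ ((one_le_div (by linarith)).2 (by linarith [ht.1])),
      hc (x, t) ⟨hx.1, by linarith [ht'.1], by linarith [ht'.2]⟩, ← Q.act_mul, mul_inv_cancel,
      Q.act_one]
  have hproj : ∀ p ∈ W ×ˢ Ioo (-Real.pi - δ / 2) (Real.pi + δ / 2),
      Q.proj (s' p) = (p.1, Circle.exp p.2) := by
    intro p hp
    rw [← hps p ⟨hp.1.1, by linarith [hp.2.1], by linarith [hp.2.2]⟩]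
    rcases lt_or_ge p.2 (Real.pi - 3 * δ / 4) with h | h
    · rw [hleft p h]
    · rw [hright p ⟨hp.1, by linarith, by linarith [hp.2.2]⟩, Q.proj_act]
  refine ⟨W, fun z => s' (z.1, Complex.arg z.2), hWo, ⟨hm, hmU₂⟩,
    contMDiffOn_circle_descent (by linarith) (by linarith) hs' hper, fun z hz => ?_,
    fun x hx => ?_⟩
  · rw [hproj _ ⟨hz.1, by linarith [Complex.neg_pi_lt_arg (z.2 : ℂ)],
      by linarith [Complex.arg_le_pi (z.2 : ℂ)]⟩, Circle.exp_arg]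
  · simp only [Circle.coe_one, Complex.arg_one]
    rw [hleft (x, 0) (by change (0 : ℝ) < _; linarith), hs0 x hx.1]

end FramedBundle

/-! ### The inverse caloron transform of a framed bundle -/

namespace FramedBundle

variable {M : Man.{u}} {Q : FramedBundle k G M}

theorem EtaPullback.proj_apply (f : Q.EtaPullback) (θ : Circle) :
    Q.proj (f.loop θ) = (f.point, θ) := congrFun f.proj_loop θ

theorem EtaPullback.loop_one (f : Q.EtaPullback) : f.loop 1 = Q.frame f.point := by
  obtain ⟨m, hm⟩ := f.loop_mem.2
  have h := f.proj_apply 1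
  rw [← hm, Q.proj_frame] at h
  rw [← hm, (Prod.mk.inj h).1]

/-- The pointwise action of `ΩG` on based loops. -/
def EtaPullback.act (f : Q.EtaPullback) (γ : LoopGroup k G) : Q.EtaPullback where
  point := f.point
  loop θ := Q.act (f.loop θ) (γ.1 θ)
  loop_mem := ⟨contMDiffOn_univ.1 (contMDiffOn_act f.loop_mem.1.contMDiffOn γ.2.1.contMDiffOn), by
    change Q.act (f.loop 1) (γ.1 1) ∈ _
    rw [γ.2.2, Q.act_one]
    exact f.loop_mem.2⟩
  proj_loop := funext fun θ => by
    change Q.proj (Q.act (f.loop θ) (γ.1 θ)) = (f.point, θ)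
    rw [Q.proj_act, f.proj_apply]

theorem EtaPullback.exists_act_eq {p q : Q.EtaPullback} (h : p.point = q.point) :
    ∃ γ : LoopGroup k G, q = p.act γ := by
  choose g hg using fun θ => Q.transitive (p := p.loop θ) (q := q.loop θ) (by
    rw [p.proj_apply, q.proj_apply, h])
  have hs : ContMDiff (𝓡 1) (𝓡 k) ∞ g := contMDiffOn_univ.1 (contMDiffOn_div
    p.loop_mem.1.contMDiffOn q.loop_mem.1.contMDiffOn fun θ _ => hg θ)
  have h1 : g 1 = 1 := by
    refine Q.act_injective (p.loop 1) ?_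
    rw [← hg 1, q.loop_one, Q.act_one, p.loop_one, h]
  exact ⟨⟨g, hs, h1⟩, ext_loop hg⟩

theorem EtaPullback.exists_local_section [ConnectedSpace G] (Q : FramedBundle k G M) (m₀ : M) :
    ∃ (U : Set M) (σ : M → Q.EtaPullback), IsOpen U ∧ m₀ ∈ U ∧ (∀ x ∈ U, (σ x).point = x) ∧
      ContMDiffOn ((𝓡 M.dim).prod (𝓡 1)) (totalModel k M.dim) ∞
        (fun z : M × Circle => (σ z.1).loop z.2) (U ×ˢ univ) := by
  obtain ⟨U, s, hU, hm, hs, hps, hs1⟩ := Q.exists_section_extending_frame m₀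
  let loopAt : ∀ x ∈ U, Q.EtaPullback := fun x hx =>
    { point := x
      loop := fun θ => s (x, θ)
      loop_mem := ⟨contMDiffOn_slice hs hx, x, (hs1 x hx).symm⟩
      proj_loop := funext fun θ => hps (x, θ) ⟨hx, mem_univ _⟩ }
  classical
  -- Outside of `U` the values of the section are irrelevant.
  let σ : M → Q.EtaPullback := fun x => if hx : x ∈ U then loopAt x hx else loopAt m₀ hm
  have hσ : ∀ x (hx : x ∈ U), σ x = loopAt x hx := fun x hx => dif_pos hx
  exact ⟨U, σ, hU, hm, fun x hx => by rw [hσ x hx], hs.congr fun z hz => by rw [hσ _ hz.1]⟩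

variable (Q) in
/-- The `ΩG`-bundle of based loops, with the atlas of all local sections `σ` for which
`(x, θ) ↦ σ(x)(θ)` is smooth. -/
def loopBundle [ConnectedSpace G] : LoopBundle k G M where
  total := Q.EtaPullback
  proj := EtaPullback.point
  act := EtaPullback.act
  act_one p := EtaPullback.ext_loop fun θ => Q.act_one _
  act_mul p γ δ := EtaPullback.ext_loop fun θ => Q.act_mul _ _ _
  proj_act p γ := rfl
  free p γ h := Subtype.ext <| funext fun θ => Q.act_injective (p.loop θ) <| by
    change (p.act γ).loop θ = Q.act (p.loop θ) 1
    rw [h, Q.act_one]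
  transitive p q h := EtaPullback.exists_act_eq h
  atlas := {s | IsOpen s.1 ∧ (∀ x ∈ s.1, (s.2 x).point = x) ∧
    ContMDiffOn ((𝓡 M.dim).prod (𝓡 1)) (totalModel k M.dim) ∞
      (fun z : M × Circle => (s.2 z.1).loop z.2) (s.1 ×ˢ univ)}
  isOpen_atlas s hs := hs.1
  section_atlas s hs := hs.2.1
  cover x := by
    obtain ⟨U, σ, hU, hx, hσ, hσs⟩ := EtaPullback.exists_local_section Q x
    exact ⟨(U, σ), ⟨hU, hσ, hσs⟩, hx⟩
  compatible := by
    rintro s ⟨hs, hsp, hss⟩ t ⟨ht, htp, hts⟩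
    have hex : ∀ x, ∃ γ : LoopGroup k G, x ∈ s.1 ∩ t.1 → t.2 x = (s.2 x).act γ := by
      intro x
      by_cases hx : x ∈ s.1 ∩ t.1
      · obtain ⟨γ, hγ⟩ := EtaPullback.exists_act_eq (p := s.2 x) (q := t.2 x) (by
          rw [hsp x hx.1, htp x hx.2])
        exact ⟨γ, fun _ => hγ⟩
      · exact ⟨1, fun h => absurd h hx⟩
    choose h hh using hex
    refine ⟨h, ?_, hh⟩
    rw [loopSmoothOn_iff (hs.inter ht)]
    refine contMDiffOn_div (hss.mono (prod_mono_left inter_subset_left))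
      (hts.mono (prod_mono_left inter_subset_right)) fun z hz => ?_
    rw [hh z.1 hz.1]
    rfl

theorem smoothOn_loopBundle_iff [ConnectedSpace G] {N : Man.{u}} {c : N → Q.EtaPullback}
    {V : Set N} (hV : IsOpen V) :
    Q.loopBundle.SmoothOn c V ↔ ContMDiffOn ((𝓡 N.dim).prod (𝓡 1)) (totalModel k M.dim) ∞
      (fun z : N × Circle => (c z.1).loop z.2) (V ×ˢ univ) := by
  refine (LoopBundle.smoothOn_iff (P := Q.loopBundle) hV).trans ?_
  constructor
  · rintro ⟨hp, hc⟩ ⟨y, θ⟩ ⟨hy : y ∈ V, -⟩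
    obtain ⟨s, hs, hys⟩ := Q.loopBundle.cover (c y).point
    obtain ⟨h, hh, hch⟩ := hc s hs
    have hW : IsOpen (V ∩ (fun y => Q.loopBundle.proj (c y)) ⁻¹' s.1) :=
      hp.continuousOn.isOpen_inter_preimage hV hs.1
    set W := V ∩ (fun y => Q.loopBundle.proj (c y)) ⁻¹' s.1
    have h1 : ContMDiffOn ((𝓡 N.dim).prod (𝓡 1)) (totalModel k M.dim) ∞
        (fun z : N × Circle => (s.2 (Q.loopBundle.proj (c z.1))).loop z.2) (W ×ˢ univ) :=
      hs.2.2.comp ((hp.comp contMDiffOn_fst fun z hz => hz.1.1).prodMk contMDiffOn_snd)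
        fun z hz => ⟨hz.1.2, mem_univ _⟩
    refine (((contMDiffOn_act h1 hh).congr fun z hz => ?_).contMDiffAt
      ((hW.prod isOpen_univ).mem_nhds (show (y, θ) ∈ W ×ˢ (univ : Set Circle) from
        ⟨⟨hy, hys⟩, mem_univ _⟩))).contMDiffWithinAt
    conv_lhs => rw [hch z.1 hz.1]
    rfl
  · intro hc
    have hp : ContMDiffOn (𝓡 N.dim) (𝓡 M.dim) ∞ (fun y => (c y).point) V := by
      have h1 := (contMDiff_fst.comp Q.smooth_proj).comp_contMDiffOn
        (hc.comp (contMDiff_id.prodMk (contMDiff_const (c := (1 : Circle)))).contMDiffOn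
          fun y hy => ⟨hy, mem_univ _⟩)
      refine h1.congr fun y _ => ?_
      simp only [Function.comp_apply, id_eq, EtaPullback.proj_apply]
    refine ⟨hp, fun s hs => ?_⟩
    have hex : ∀ y, ∃ γ : LoopGroup k G, (c y).point ∈ s.1 →
        c y = (s.2 (c y).point).act γ := by
      intro y
      by_cases hy : (c y).point ∈ s.1
      · obtain ⟨γ, hγ⟩ := EtaPullback.exists_act_eq (p := s.2 (c y).point) (q := c y)
          (hs.2.1 _ hy)
        exact ⟨γ, fun _ => hγ⟩
      · exact ⟨1, fun h => absurd h hy⟩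
    choose h hh using hex
    refine ⟨h, ?_, fun y hy => hh y hy.2⟩
    refine contMDiffOn_div (Q := Q)
      (f := fun z : N × Circle => (s.2 (c z.1).point).loop z.2)
      (f' := fun z : N × Circle => (c z.1).loop z.2)
      (hs.2.2.comp ((hp.comp contMDiffOn_fst fun z hz => hz.1.1).prodMk contMDiffOn_snd)
        fun z hz => ⟨hz.1.2, mem_univ _⟩)
      (hc.mono (prod_mono_left inter_subset_left)) fun z hz => ?_
    conv_lhs => rw [hh z.1 hz.1.2]
    rfl

end FramedBundle

theorem nonempty_inverseCaloronTransform [ConnectedSpace G] :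
    Nonempty (InverseCaloronTransform k G) := by
  let F : ∀ {X Y : FrBun k G} (_ : X ⟶ Y), X.bundle.EtaPullback → Y.bundle.EtaPullback :=
    fun {X Y} φ f =>
      { point := Man.fn φ.base f.point
        loop := fun θ => φ.total (f.loop θ)
        loop_mem := ⟨φ.smooth.comp f.loop_mem.1, Man.fn φ.base f.point, by
          change _ = φ.total (f.loop 1)
          rw [f.loop_one]
          exact (φ.total_frame _).symm⟩
        proj_loop := funext fun θ => by
          change Y.bundle.proj (φ.total (f.loop θ)) = (Man.fn φ.base f.point, θ)
          rw [φ.proj_total, f.proj_apply] }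
  exact ⟨{
    obj := fun {M} Q => Q.loopBundle
    equiv := fun {M} Q => Equiv.refl _
    isInverseCaloronTransform := fun {M} Q =>
      ⟨fun _ => rfl, fun _ _ _ => rfl, fun N c V hV => FramedBundle.smoothOn_loopBundle_iff hV⟩
    map := fun {X Y} φ =>
      { base := φ.base
        total := F φ
        proj_total := fun _ => rfl
        total_act := fun p γ => FramedBundle.EtaPullback.ext_loop fun θ => φ.total_act _ _
        smooth := fun N c V hV hc => by
          have h := (FramedBundle.smoothOn_loopBundle_iff (Q := X.bundle) hV).1 hc
          exact (FramedBundle.smoothOn_loopBundle_iff (Q := Y.bundle) (c := fun y => F φ (c y))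
            hV).2 (φ.smooth.comp_contMDiffOn h) }
    map_base := fun _ => rfl
    map_total := fun _ _ _ => rfl }⟩

/-! ### The natural isomorphisms -/

section Unit

variable (c : CaloronTransform k G) (d : InverseCaloronTransform k G)

theorem CaloronTransform.contMDiff_cls {M : Man.{u}} (P : LoopBundle k G M) (p : P.total) :
    ContMDiff (𝓡 1) (totalModel k M.dim) ∞ fun θ => c.quot P (P.cls p 1 θ) :=
  contMDiffOn_slice ((c.isCaloronTransform P).smooth_section isOpen_univ
    (LoopBundle.smoothOn_const (N := M) p)) (mem_univ (P.proj p))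

/-- The loop `θ ↦ [p, 1, θ]`. -/
def CaloronTransform.unitLoop {M : Man.{u}} (P : LoopBundle k G M) (p : P.total) :
    (c.obj P).EtaPullback where
  point := P.proj p
  loop θ := c.quot P (P.cls p 1 θ)
  loop_mem := ⟨c.contMDiff_cls P p, P.proj p, (c.isCaloronTransform P).frame p⟩
  proj_loop := funext fun θ => (c.isCaloronTransform P).proj p 1 θ

/-- The bundle map `p ↦ (θ ↦ [p, 1, θ])`. -/
def unitHom (X : Bun k G) : X ⟶ (c.functor ⋙ d.functor).obj X :=
  Bun.Hom.mk (X := X) (Y := ⟨X.base, d.obj (c.obj X.bundle)⟩) (𝟙 X.base)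
    (fun p => (d.equiv (c.obj X.bundle)).symm (c.unitLoop X.bundle p))
    (fun p => by
      rw [← (d.isInverseCaloronTransform (c.obj X.bundle)).proj, Equiv.apply_symm_apply]
      rfl)
    (fun p γ => by
      refine (d.equiv (c.obj X.bundle)).injective (FramedBundle.EtaPullback.ext_loop fun θ => ?_)
      rw [(d.isInverseCaloronTransform (c.obj X.bundle)).act, Equiv.apply_symm_apply,
        Equiv.apply_symm_apply]
      change c.quot X.bundle (X.bundle.cls (X.bundle.act p γ) 1 θ) =
        (c.obj X.bundle).act (c.quot X.bundle (X.bundle.cls p 1 θ)) (γ.1 θ)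
      rw [(c.isCaloronTransform X.bundle).act, LoopBundle.cls_act, mul_one, one_mul])
    (fun N f V hV hf => by
      change (d.obj (c.obj X.bundle)).SmoothOn
        (fun y => (d.equiv (c.obj X.bundle)).symm (c.unitLoop X.bundle (f y))) V
      rw [(d.isInverseCaloronTransform (c.obj X.bundle)).smooth_iff N _ V hV]
      simp only [Equiv.apply_symm_apply]
      exact (c.isCaloronTransform X.bundle).smooth_section hV hf)

theorem unitHom_loop (X : Bun k G) (p : X.bundle.total) (θ : Circle) :
    (d.equiv (c.obj X.bundle) ((unitHom c d X).total p)).loop θ =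
      c.quot X.bundle (X.bundle.cls p 1 θ) := by
  change (d.equiv (c.obj X.bundle)
    ((d.equiv (c.obj X.bundle)).symm (c.unitLoop X.bundle p))).loop θ = _
  rw [Equiv.apply_symm_apply]
  rfl

theorem unitHom_naturality {X Y : Bun k G} (φ : X ⟶ Y) :
    φ ≫ unitHom c d Y = unitHom c d X ≫ (c.functor ⋙ d.functor).map φ := by
  refine Bun.Hom.ext ?_ (funext fun p => ?_)
  · change φ.base ≫ 𝟙 Y.base = 𝟙 X.base ≫ (d.map (c.map φ)).base
    rw [d.map_base, c.map_base, Category.comp_id, Category.id_comp]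
  · refine (d.equiv (c.obj Y.bundle)).injective (FramedBundle.EtaPullback.ext_loop fun θ => ?_)
    refine (unitHom_loop c d Y (φ.total p) θ).trans (Eq.symm ?_)
    refine (d.map_total (c.map φ) ((unitHom c d X).total p) θ).trans ?_
    exact (congrArg (c.map φ).total (unitHom_loop c d X p θ)).trans (c.map_total φ p 1 θ)

/-- The isomorphism with underlying map `unitHom`. -/
def unitIso (X : Bun k G) : X ≅ (c.functor ⋙ d.functor).obj X :=
  (LoopBundle.exists_iso (P := X.bundle) (P' := d.obj (c.obj X.bundle)) (unitHom c d X)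
    rfl).choose

theorem unitIso_hom (X : Bun k G) : (unitIso c d X).hom = unitHom c d X :=
  (LoopBundle.exists_iso (P := X.bundle) (P' := d.obj (c.obj X.bundle)) (unitHom c d X)
    rfl).choose_spec

theorem unitIso_inv_base (X : Bun k G) : (unitIso c d X).inv.base = 𝟙 X.base := by
  have h : (unitIso c d X).hom.base ≫ (unitIso c d X).inv.base = 𝟙 X.base :=
    congrArg Bun.Hom.base (unitIso c d X).hom_inv_id
  rw [unitIso_hom] at h
  exact (Category.id_comp _).symm.trans h

/-- The natural isomorphism `α`, inverse to `p ↦ (θ ↦ [p, 1, θ])`. -/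
def unitNatIso : c.functor ⋙ d.functor ≅ 𝟭 (Bun k G) :=
  (NatIso.ofComponents (unitIso c d) fun φ => by
    rw [unitIso_hom, unitIso_hom]
    exact unitHom_naturality c d φ).symm

end Unit

section Counit

variable (c : CaloronTransform k G) (d : InverseCaloronTransform k G)

/-- The map `[f, g, θ] ↦ f(θ) g`. -/
def counitFun {M : Man.{u}} (Q : FramedBundle k G M) (a : (c.obj (d.obj Q)).total) : Q.total :=
  Quotient.lift (s := (d.obj Q).orbitSetoid)
    (fun a => Q.act ((d.equiv Q a.1).loop a.2.2) a.2.1) (by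
      rintro ⟨p, g, θ⟩ _ ⟨γ, rfl⟩
      simp only
      rw [(d.isInverseCaloronTransform Q).act, ← Q.act_mul, mul_inv_cancel_left])
    ((c.quot (d.obj Q)).symm a)

theorem counitFun_cls {M : Man.{u}} (Q : FramedBundle k G M) (p : (d.obj Q).total) (g : G)
    (θ : Circle) : counitFun c d Q (c.quot (d.obj Q) ((d.obj Q).cls p g θ)) =
      Q.act ((d.equiv Q p).loop θ) g := by
  rw [counitFun, Equiv.symm_apply_apply]
  rfl

theorem counitFun_act {M : Man.{u}} (Q : FramedBundle k G M) (a : (c.obj (d.obj Q)).total)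
    (g : G) : counitFun c d Q ((c.obj (d.obj Q)).act a g) = Q.act (counitFun c d Q a) g := by
  obtain ⟨p, g', θ, rfl⟩ := c.exists_cls (d.obj Q) a
  rw [(c.isCaloronTransform _).act, counitFun_cls, counitFun_cls, Q.act_mul]

/-- The framed bundle map `[f, g, θ] ↦ f(θ) g`. -/
def counitHom (Y : FrBun k G) : (d.functor ⋙ c.functor).obj Y ⟶ Y :=
  FrBun.Hom.mk (X := ⟨Y.base, c.obj (d.obj Y.bundle)⟩) (Y := Y) (𝟙 Y.base)
    (counitFun c d Y.bundle)
    (fun a => by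
      change Y.bundle.proj (counitFun c d Y.bundle a) = (c.obj (d.obj Y.bundle)).proj a
      obtain ⟨p, g, θ, rfl⟩ := c.exists_cls (d.obj Y.bundle) a
      rw [counitFun_cls, Y.bundle.proj_act, FramedBundle.EtaPullback.proj_apply,
        (d.isInverseCaloronTransform _).proj, (c.isCaloronTransform _).proj])
    (counitFun_act c d Y.bundle)
    (fun m => by
      change counitFun c d Y.bundle ((c.obj (d.obj Y.bundle)).frame m) = Y.bundle.frame m
      obtain ⟨s, hs, hm⟩ := (d.obj Y.bundle).cover m
      have h := (d.obj Y.bundle).section_atlas s hs m hm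
      rw [← h, (c.isCaloronTransform _).frame, counitFun_cls, Y.bundle.act_one,
        FramedBundle.EtaPullback.loop_one, (d.isInverseCaloronTransform _).proj])
    ((c.isCaloronTransform (d.obj Y.bundle)).contMDiff (counitFun_act c d Y.bundle)
      fun s hs => by
        simp only [counitFun_cls, Y.bundle.act_one]
        have hU := (d.obj Y.bundle).isOpen_atlas s hs
        exact ((d.isInverseCaloronTransform Y.bundle).smooth_iff _ _ _ hU).1
          (LoopBundle.smoothOn_section hs))

theorem counitHom_cls (Y : FrBun k G) (p : (d.obj Y.bundle).total) (g : G) (θ : Circle) :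
    (counitHom c d Y).total (c.quot (d.obj Y.bundle) ((d.obj Y.bundle).cls p g θ)) =
      Y.bundle.act ((d.equiv Y.bundle p).loop θ) g :=
  counitFun_cls c d Y.bundle p g θ

theorem counitHom_naturality {X Y : FrBun k G} (φ : X ⟶ Y) :
    (d.functor ⋙ c.functor).map φ ≫ counitHom c d Y = counitHom c d X ≫ φ := by
  refine FrBun.Hom.ext ?_ (funext fun a => ?_)
  · change (c.map (d.map φ)).base ≫ 𝟙 Y.base = 𝟙 X.base ≫ φ.base
    rw [c.map_base, d.map_base, Category.comp_id, Category.id_comp]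
  · obtain ⟨p, g, θ, rfl⟩ := c.exists_cls (d.obj X.bundle) a
    change counitFun c d Y.bundle ((c.map (d.map φ)).total
        (c.quot (d.obj X.bundle) ((d.obj X.bundle).cls p g θ))) =
      φ.total (counitFun c d X.bundle (c.quot (d.obj X.bundle) ((d.obj X.bundle).cls p g θ)))
    have h := c.map_total (d.map φ) p g θ
    refine (congrArg (counitFun c d Y.bundle) h).trans ?_
    rw [counitFun_cls, counitFun_cls, φ.total_act, d.map_total]

/-- The isomorphism with underlying map `counitHom`. -/
def counitIso (Y : FrBun k G) : (d.functor ⋙ c.functor).obj Y ≅ Y :=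
  (FramedBundle.exists_iso (Q := c.obj (d.obj Y.bundle)) (Q' := Y.bundle) (counitHom c d Y)
    rfl).choose

theorem counitIso_hom (Y : FrBun k G) : (counitIso c d Y).hom = counitHom c d Y :=
  (FramedBundle.exists_iso (Q := c.obj (d.obj Y.bundle)) (Q' := Y.bundle) (counitHom c d Y)
    rfl).choose_spec

/-- The natural isomorphism `β : [f, g, θ] ↦ f(θ) g`. -/
def counitNatIso : d.functor ⋙ c.functor ≅ 𝟭 (FrBun k G) :=
  NatIso.ofComponents (counitIso c d) fun φ => by
    rw [counitIso_hom, counitIso_hom]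
    exact counitHom_naturality c d φ

end Counit

end Caloron

end

theorem propositionP (k : ℕ) (G : Type u) [TopologicalSpace G]
    [ChartedSpace (EuclideanSpace ℝ (Fin k)) G] [Group G] [LieGroup (𝓡 k) ∞ G]
    [T2Space G] [CompactSpace G] [ConnectedSpace G] :
    ∃ (c : Caloron.CaloronTransform k G) (d : Caloron.InverseCaloronTransform k G),
      -- both functors commute with the projections to the category of manifolds
      c.functor ⋙ Caloron.FrBun.projection k G = Caloron.Bun.projection k G ∧
      d.functor ⋙ Caloron.Bun.projection k G = Caloron.FrBun.projection k G ∧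
      -- they are equivalences of categories, inverse to each other through the natural
      -- isomorphisms `α⁻¹ : p ↦ (θ ↦ [p, 1, θ])` and `β : [f, g, θ] ↦ f(θ) g`
      c.functor.IsEquivalence ∧ d.functor.IsEquivalence ∧
      (∃ α : c.functor ⋙ d.functor ≅ 𝟭 (Caloron.Bun k G),
        ∀ (X : Caloron.Bun k G),
          (α.hom.app X).base = 𝟙 X.base ∧
          ∀ (p : X.bundle.total) (θ : Circle),
            (d.equiv (c.obj X.bundle) ((α.inv.app X).total p)).loop θ =
              c.quot X.bundle (X.bundle.cls p 1 θ)) ∧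
      (∃ β : d.functor ⋙ c.functor ≅ 𝟭 (Caloron.FrBun k G),
        ∀ (Y : Caloron.FrBun k G),
          (β.hom.app Y).base = 𝟙 Y.base ∧
          ∀ (p : (d.obj Y.bundle).total) (g : G) (θ : Circle),
            (β.hom.app Y).total (c.quot (d.obj Y.bundle) ((d.obj Y.bundle).cls p g θ)) =
              Y.bundle.act ((d.equiv Y.bundle p).loop θ) g) ∧
      -- for every manifold they induce mutually inverse bijections on isomorphism classes
      (∀ M : Caloron.Man.{u}, ∃ Φ : Quotient (Caloron.LoopBundle.isoSetoid k G M) ≃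
          Quotient (Caloron.FramedBundle.isoSetoid k G M),
        (∀ P : Caloron.LoopBundle k G M, Φ (Quotient.mk _ P) = Quotient.mk _ (c.obj P)) ∧
        (∀ Q : Caloron.FramedBundle k G M, Φ.symm (Quotient.mk _ Q) = Quotient.mk _ (d.obj Q))) := by
  obtain ⟨c⟩ := Caloron.nonempty_caloronTransform (k := k) (G := G)
  obtain ⟨d⟩ := Caloron.nonempty_inverseCaloronTransform (k := k) (G := G)
  let α := Caloron.unitNatIso c d
  let β := Caloron.counitNatIso c d
  have hα : ∀ X, (α.hom.app X).base = 𝟙 X.base := Caloron.unitIso_inv_base c d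
  have hβ : ∀ Y, (β.hom.app Y).base = 𝟙 Y.base := fun Y => by
    change (Caloron.counitIso c d Y).hom.base = 𝟙 Y.base
    rw [Caloron.counitIso_hom]
    rfl
  refine ⟨c, d, ?_, ?_, (CategoryTheory.Equivalence.mk c.functor d.functor α.symm
    β).isEquivalence_functor, (CategoryTheory.Equivalence.mk d.functor c.functor β.symm
    α).isEquivalence_functor, ⟨α, fun X => ⟨hα X, fun p θ => ?_⟩⟩,
    ⟨β, fun Y => ⟨hβ Y, fun p g θ => ?_⟩⟩, fun M => ?_⟩
  · exact CategoryTheory.Functor.ext (fun X => rfl) fun X Y φ => by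
      simpa using! c.map_base φ
  · exact CategoryTheory.Functor.ext (fun X => rfl) fun X Y φ => by
      simpa using! d.map_base φ
  · change (d.equiv (c.obj X.bundle) ((Caloron.unitIso c d X).hom.total p)).loop θ = _
    rw [Caloron.unitIso_hom, Caloron.unitHom_loop]
  · change (Caloron.counitIso c d Y).hom.total _ = _
    rw [Caloron.counitIso_hom, Caloron.counitHom_cls]
  · refine ⟨⟨Quotient.map (sa := Caloron.LoopBundle.isoSetoid k G M)
      (sb := Caloron.FramedBundle.isoSetoid k G M) c.obj ?_,
      Quotient.map (sa := Caloron.FramedBundle.isoSetoid k G M)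
      (sb := Caloron.LoopBundle.isoSetoid k G M) d.obj ?_, ?_, ?_⟩, fun P => rfl, fun Q => rfl⟩
    · rintro P P' ⟨i, hi⟩
      exact ⟨c.functor.mapIso i, (c.map_base i.hom).trans hi⟩
    · rintro Q Q' ⟨i, hi⟩
      exact ⟨d.functor.mapIso i, (d.map_base i.hom).trans hi⟩
    · intro x
      obtain ⟨P, rfl⟩ := Quotient.exists_rep x
      exact Quotient.sound (s := Caloron.LoopBundle.isoSetoid k G M) ⟨α.app ⟨M, P⟩, hα ⟨M, P⟩⟩
    · intro x
      obtain ⟨Q, rfl⟩ := Quotient.exists_rep x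
      exact Quotient.sound (s := Caloron.FramedBundle.isoSetoid k G M) ⟨β.app ⟨M, Q⟩, hβ ⟨M, Q⟩⟩
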